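/- **Setting.** Let $(X,d_X)$ be a proper geodesic Gromov hyperbolic metric space with Gromov boundary $\partial_\infty X$, fix $o\in X$, and let $\Gamma\subset \mathsf{Isom}(X)$ be a discrete subgroup whose action on $M=\partial_\infty X$ is non-elementary, i.e. its limit set has at least $3$ points. Here the limit set is the set of $x\in M$ for which there are $y\in M$ and a sequence $(\gamma_n)$ in $\Gamma$ such that $\gamma_n|_{M\smallsetminus\{y\}}$ converges locally uniformly to $x$. Write $M^{(2)}=\{(x,y)\in M^2: x\neq y\}$. A function $\psi\colon X\times X\to\mathbb R$ is a *coarsely additive potential* if 1. $\lim_{r\to\infty}\inf_{d_X(p,q)\ge r}\psi(p,q)=+\infty$; 2. $\sup_{d_X(p,q)\le r}|\psi(p,q)|<+\infty$ for every $r>0$; 3. for every $r>0$ there is $\kappa(r)>0$ such that $|\psi(p,q)-(\psi(p,u)+\psi(u,q))|\le\kappa(r)$ whenever $u$ lies in the $r$-neighborhood of a geodesic joining $p$ to $q$. **Definitions.** A group $G$ acting by homeomorphisms on a compact metrizable space $N$ acts as a *convergence group* if for every sequence $(\gamma_n)$ of distinct elements of $G$ there are $x,y\in N$ and a subsequence $(\gamma_{n_j})$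 such that $\gamma_{n_j}|_{N\smallsetminus\{y\}}$ converges locally uniformly to $x$. An element $\gamma\in\Gamma$ is *loxodromic* if it has two distinct fixed points $\gamma^\pm$ in the limit set such that $\gamma^{\pm n}|_{M\smallsetminus\{\gamma^\mp\}}$ converges locally uniformly to $\gamma^\pm$ as $n\to\infty$. A metric $d$ on $\Gamma\sqcup M$ is *compatible* if it makes $\Gamma\sqcup M$ compact, the inclusions of $\Gamma$ (with the discrete topology) and of $M$ are topological embeddings, and $\Gamma$ acts on $\Gamma\sqcup M$ (by left multiplication on $\Gamma$) as a convergence group. A function $\sigma\colon\Gamma\times M\to\mathbb R$ is a *$\kappa$-coarse-cocycle* if $\limsup_{x\to x_0}|\sigma(\gamma,x_0)-\sigma(\gamma,x)|\le\kappa$ and $|\sigma(\gamma_1\gamma_2,x)-(\sigma(\gamma_1,\gamma_2x)+\sigma(\gamma_2,x))|\le\kappa$ for all $\gamma,\gamma_1,\gamma_2\in\Gamma$ and $x_0,x\in M$. It is *proper* if, for every compatible metric $d$, $\sigma(\gamma_n,\gamma_n^+)\to+\infty$ for every sequence of distinct loxodromic elements $\gamma_n$ with $\liminf_n d(\gamma_n^-,\gamma_n^+)>0$.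 It is *expanding with magnitude* $\gamma\mapsto\|\gamma\|\in\mathbb R$ if it is a proper coarse-cocycle and, for every compatible metric $d$ and every $\epsilon>0$, there is $C>0$ such that $\|\gamma\|-C\le\sigma(\gamma,x)\le\|\gamma\|+C$ whenever $x\in M$, $\gamma\in\Gamma$ and $d(x,\gamma^{-1})>\epsilon$. A triple $(\sigma,\bar\sigma,G)$ is a *$\kappa$-coarse GPS system* on $M$ if $\Gamma$ acts on $M$ as a non-elementary convergence group, $\sigma,\bar\sigma\colon\Gamma\times M\to\mathbb R$ are proper $\kappa$-coarse-cocycles, $G\colon M^{(2)}\to\mathbb R$ is locally bounded, and $$\big|\big(\bar\sigma(\gamma,x)+\sigma(\gamma,y)\big)-\big(G(\gamma x,\gamma y)-G(x,y)\big)\big|\le\kappa$$ for all $\gamma\in\Gamma$ and distinct $x,y\in M$. A *coarse GPS system* is a $\kappa$-coarse one for some $\kappa$. **Theorem 1.8 (restated as Theorem 15.1).** Let $\psi$ be a coarsely additive potential with $\psi(\gamma p,\gamma q)=\psi(p,q)$ for all $\gamma\in\Gamma$ and $p,q\in X$. Define, with values in $[-\infty,\infty]$, $$\sigma_\psi(\gamma,x)=\limsup_{p\to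 x}\,\big(\psi(\gamma^{-1}o,p)-\psi(o,p)\big),\qquad \bar\sigma_\psi(\gamma,x)=\limsup_{p\to x}\,\big(\psi(p,\gamma^{-1}o)-\psi(p,o)\big)$$ for $\gamma\in\Gamma$, $x\in\partial_\infty X$, and $$G_\psi(x,y)=\limsup_{p\to x,\ q\to y}\,\big(\psi(p,o)+\psi(o,q)-\psi(p,q)\big)$$ for $(x,y)\in\partial_\infty X^{(2)}$, where $p,q\in X$ converge to the boundary points in $X\sqcup\partial_\infty X$. Then all these quantities are finite, $G_\psi$ is bounded below, and $(\sigma_\psi,\bar\sigma_\psi,G_\psi)$ is a coarse GPS system on $\partial_\infty X$. Moreover, $\Gamma\sqcup\partial_\infty X$ admits a compatible metric, and $\sigma_\psi$ is expanding with magnitude $\|\gamma\|=\psi(o,\gamma o)$. -/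

import Mathlib

open Filter Topology Set

open scoped NNReal

universe u v

noncomputable section

/-! ## Geodesics and Gromov hyperbolicity -/

/-- `c` restricted to `[0, dist p q]` is a geodesic segment (parametrised by arc length)
joining `p` to `q`. -/
def IsGeodesicSegment {X : Type u} [MetricSpace X] (c : ℝ → X) (p q : X) : Prop :=
  c 0 = p ∧ c (dist p q) = q ∧
    ∀ s ∈ Icc (0 : ℝ) (dist p q), ∀ t ∈ Icc (0 : ℝ) (dist p q), dist (c s) (c t) = |s - t|

/-- Any two points are joined by a geodesic segment. -/
def IsGeodesicSpace (X : Type u) [MetricSpace X] : Prop :=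
  ∀ p q : X, ∃ c : ℝ → X, IsGeodesicSegment c p q

/-- Gromov hyperbolicity of a geodesic space: for some `δ`, all geodesic triangles are
`δ`-slim (each side lies in the `δ`-neighbourhood of the union of the two other sides). -/
def IsGromovHyperbolic (X : Type u) [MetricSpace X] : Prop :=
  ∃ δ : ℝ, ∀ (p q r : X) (c₁ c₂ c₃ : ℝ → X),
    IsGeodesicSegment c₁ p q → IsGeodesicSegment c₂ p r → IsGeodesicSegment c₃ r q →
    ∀ s ∈ Icc (0 : ℝ) (dist p q),
      (∃ t ∈ Icc (0 : ℝ) (dist p r), dist (c₁ s) (c₂ t) ≤ δ) ∨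
      (∃ t ∈ Icc (0 : ℝ) (dist r q), dist (c₁ s) (c₃ t) ≤ δ)

/-! ## The Gromov boundary and the compactification `X ⊔ ∂X` -/

/-- Geodesic rays. -/
def GeodesicRay (X : Type u) [MetricSpace X] : Type u := {r : ℝ≥0 → X // Isometry r}

/-- Two geodesic rays are asymptotic if they stay at bounded distance from each other. -/
def geodesicRaySetoid (X : Type u) [MetricSpace X] : Setoid (GeodesicRay X) where
  r a b := ∃ C : ℝ, ∀ t, dist (a.1 t) (b.1 t) ≤ C
  iseqv :=
    { refl := fun a => ⟨0, fun t => by simp⟩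
      symm := fun {a b} ⟨C, h⟩ => ⟨C, fun t => by rw [dist_comm]; exact h t⟩
      trans := fun {a b c} ⟨C, h⟩ ⟨D, k⟩ =>
        ⟨C + D, fun t => (dist_triangle _ (b.1 t) _).trans (add_le_add (h t) (k t))⟩ }

/-- The Gromov boundary `∂X`: asymptoty classes of geodesic rays. -/
def GromovBoundary (X : Type u) [MetricSpace X] : Type u := Quotient (geodesicRaySetoid X)

/-- The endpoint at infinity of a geodesic ray. -/
def GeodesicRay.endpoint {X : Type u} [MetricSpace X] (r : GeodesicRay X) : GromovBoundary X :=
  Quotient.mk (geodesicRaySetoid X) r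

/-- The set `X ⊔ ∂X`. -/
inductive GromovBordification (X : Type u) [MetricSpace X] : Type u
  | of (p : X) : GromovBordification X
  | bdry (ξ : GromovBoundary X) : GromovBordification X

/-- The Gromov product `(p|q)_o` of points of `X`. -/
def gromovProd {X : Type u} [MetricSpace X] (o p q : X) : ℝ :=
  (dist o p + dist o q - dist p q) / 2

/-- The paths representing a point of `X ⊔ ∂X`: the constant path for a point of `X`, the
geodesic rays in the class for a point of `∂X`. -/
def GromovBordification.reps {X : Type u} [MetricSpace X] :
    GromovBordification X → Set (ℝ≥0 → X)
  | .of p => {fun _ => p}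
  | .bdry ξ => {c | ∃ r : GeodesicRay X, r.endpoint = ξ ∧ r.1 = c}

/-- The Gromov product extended to `X ⊔ ∂X`: the supremum over representatives `c`, `c'` of
`liminf_{s,t → ∞} (c(s)|c'(t))_o`. -/
def extGromovProd {X : Type u} [MetricSpace X] (o : X) (z w : GromovBordification X) : EReal :=
  ⨆ c ∈ z.reps, ⨆ c' ∈ w.reps,
    liminf (fun q : ℝ≥0 × ℝ≥0 => ((gromovProd o (c q.1) (c' q.2) : ℝ) : EReal))
      (atTop ×ˢ atTop)

/-- The topology of `X ⊔ ∂X`: `X` with its own topology is open, and the sets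
`{z | (ξ|z)_o > R}`, `R ∈ ℝ`, are a neighbourhood basis of `ξ ∈ ∂X`. (In a hyperbolic space
changing the base point changes the Gromov product by a bounded amount only, so asking for all
base points is the same as asking for one of them.) -/
instance (X : Type u) [MetricSpace X] : TopologicalSpace (GromovBordification X) where
  IsOpen U :=
    IsOpen {p : X | GromovBordification.of p ∈ U} ∧
      ∀ ξ : GromovBoundary X, GromovBordification.bdry ξ ∈ U → ∀ o : X, ∃ R : ℝ,
        ∀ z : GromovBordification X,
          (R : EReal) < extGromovProd o (GromovBordification.bdry ξ) z → z ∈ U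
  isOpen_univ := ⟨by simp, fun _ _ _ => ⟨0, fun _ _ => mem_univ _⟩⟩
  isOpen_inter := by
    rintro U V ⟨hU, hU'⟩ ⟨hV, hV'⟩
    refine ⟨hU.inter hV, fun ξ hξ o => ?_⟩
    obtain ⟨R, hR⟩ := hU' ξ hξ.1 o
    obtain ⟨S, hS⟩ := hV' ξ hξ.2 o
    refine ⟨max R S, fun z hz => ⟨hR z (lt_of_le_of_lt ?_ hz), hS z (lt_of_le_of_lt ?_ hz)⟩⟩
    · exact EReal.coe_le_coe_iff.2 (le_max_left R S)
    · exact EReal.coe_le_coe_iff.2 (le_max_right R S)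
  isOpen_sUnion := by
    intro 𝒰 h
    constructor
    · have h2 : {p : X | GromovBordification.of p ∈ ⋃₀ 𝒰} =
          ⋃ U ∈ 𝒰, {p : X | GromovBordification.of p ∈ U} := by
        ext p
        simp
      rw [h2]
      exact isOpen_biUnion fun U hU => (h U hU).1
    · rintro ξ ⟨U, hU, hξ⟩ o
      obtain ⟨R, hR⟩ := (h U hU).2 ξ hξ o
      exact ⟨R, fun z hz => ⟨U, hU, hR z hz⟩⟩

/-- `∂X` carries the subspace topology from `X ⊔ ∂X`. -/
instance (X : Type u) [MetricSpace X] : TopologicalSpace (GromovBoundary X) :=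
  TopologicalSpace.induced GromovBordification.bdry inferInstance

/-- The filter "`p → ξ`", for `p ∈ X` tending to the boundary point `ξ` in `X ⊔ ∂X`. -/
def towards {X : Type u} [MetricSpace X] (ξ : GromovBoundary X) : Filter X :=
  comap GromovBordification.of (𝓝 (GromovBordification.bdry ξ))

/-- The image of a geodesic ray under an isometry. -/
def GeodesicRay.map {X : Type u} [MetricSpace X] (g : X ≃ᵢ X) (r : GeodesicRay X) :
    GeodesicRay X :=
  ⟨fun t => g (r.1 t), g.isometry.comp r.2⟩

/-- Isometries act on the Gromov boundary. -/
instance (X : Type u) [MetricSpace X] : MulAction (X ≃ᵢ X) (GromovBoundary X) where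
  smul g := Quotient.map (sa := geodesicRaySetoid X) (sb := geodesicRaySetoid X)
    (GeodesicRay.map g) (fun a b ⟨C, h⟩ => ⟨C, fun t => by
      change dist (g (a.1 t)) (g (b.1 t)) ≤ C
      rw [g.isometry.dist_eq]
      exact h t⟩)
  one_smul := by
    intro x
    induction x using Quotient.inductionOn
    rfl
  mul_smul := by
    intro g h x
    induction x using Quotient.inductionOn
    rfl

/-- A group of isometries is discrete if it is discrete for the compact-open topology. -/
def IsDiscreteIsometryGroup {X : Type u} [MetricSpace X] (Γ : Subgroup (X ≃ᵢ X)) : Prop :=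
  @DiscreteTopology Γ (TopologicalSpace.induced
    (fun γ : Γ => (⟨(γ : X ≃ᵢ X), (γ : X ≃ᵢ X).continuous⟩ : C(X, X))) inferInstance)

/-! ## Convergence groups -/

/-- The maps `γ n`, restricted to `M ∖ {b}`, converge locally uniformly to the constant `a`. -/
def CollapsesTo {G : Type u} {M : Type v} [Group G] [MulAction G M] [TopologicalSpace M]
    (γ : ℕ → G) (b a : M) : Prop :=
  ∀ z : M, z ≠ b → ∀ U ∈ 𝓝 a, ∃ V ∈ 𝓝 z, ∀ᶠ n in atTop, ∀ w ∈ V, w ≠ b → γ n • w ∈ U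

/-- `G` acts on the compact metrizable space `M` by homeomorphisms as a (discrete) convergence
group. -/
structure IsConvergenceGroup (G : Type u) (M : Type v) [Group G] [MulAction G M]
    [TopologicalSpace M] : Prop where
  compact : CompactSpace M
  metrizable : TopologicalSpace.MetrizableSpace M
  continuous : ∀ g : G, Continuous fun x : M => g • x
  collapse : ∀ γ : ℕ → G, Function.Injective γ →
    ∃ (a b : M) (φ : ℕ → ℕ), StrictMono φ ∧ CollapsesTo (γ ∘ φ) b a

/-- The limit set of a convergence group. -/
def limitSet (G : Type u) (M : Type v) [Group G] [MulAction G M] [TopologicalSpace M] : Set M :=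
  {a | ∃ (b : M) (γ : ℕ → G), CollapsesTo γ b a}

/-- Non-elementary: the limit set contains at least three points. -/
def IsNonElementary (G : Type u) (M : Type v) [Group G] [MulAction G M] [TopologicalSpace M] :
    Prop :=
  3 ≤ (limitSet G M).encard

/-- `g` is loxodromic with attracting fixed point `a` (`= g⁺`) and repelling fixed point `b`
(`= g⁻`). -/
structure IsLoxodromic {G : Type u} {M : Type v} [Group G] [MulAction G M] [TopologicalSpace M]
    (g : G) (a b : M) : Prop where
  ne : a ≠ b
  attracting_mem : a ∈ limitSet G M
  repelling_mem : b ∈ limitSet G M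
  attracting_fixed : g • a = a
  repelling_fixed : g • b = b
  attracts : CollapsesTo (fun n : ℕ => g ^ n) b a
  repels : CollapsesTo (fun n : ℕ => (g⁻¹) ^ n) a b

/-- The set `G ⊔ M`. -/
inductive GroupUnion (G : Type u) (M : Type v) : Type (max u v)
  | elt (g : G) : GroupUnion G M
  | pt (x : M) : GroupUnion G M

/-- `G` acts on `G ⊔ M` by left multiplication on `G` and by the given action on `M`. -/
instance (G : Type u) (M : Type v) [Group G] [MulAction G M] :
    MulAction G (GroupUnion G M) where
  smul g z := match z with
    | .elt h => .elt (g * h)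
    | .pt x => .pt (g • x)
  one_smul := by
    rintro (h | x)
    · exact congrArg GroupUnion.elt (one_mul h)
    · exact congrArg GroupUnion.pt (one_smul G x)
  mul_smul := by
    rintro g g' (h | x)
    · exact congrArg GroupUnion.elt (mul_assoc g g' h)
    · exact congrArg GroupUnion.pt (mul_smul g g' x)

/-- A metric on `G ⊔ M` is compatible if its topology is compactifying: it is compact, the
inclusions of `G` (with the discrete topology) and of `M` are embeddings, and `G` acts on
`G ⊔ M` as a convergence group. -/
structure IsCompatibleMetric {G : Type u} {M : Type v} [Group G] [MulAction G M]
    [TopologicalSpace M] (d : MetricSpace (GroupUnion G M)) : Prop where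
  compact : CompactSpace (GroupUnion G M)
  embedding_elt : @IsEmbedding G (GroupUnion G M) ⊥ _ GroupUnion.elt
  embedding_pt : IsEmbedding (GroupUnion.pt : M → GroupUnion G M)
  convergence : IsConvergenceGroup G (GroupUnion G M)

/-! ## Coarse cocycles and coarse GPS systems -/

/-- `κ`-coarse-cocycles `σ : G × M → ℝ`. -/
structure IsCoarseCocycle {G : Type u} {M : Type v} [Group G] [MulAction G M]
    [TopologicalSpace M] (κ : ℝ) (σ : G → M → ℝ) : Prop where
  coarse_continuous : ∀ (g : G) (x₀ : M),
    limsup (fun x => ((|σ g x₀ - σ g x| : ℝ) : EReal)) (𝓝 x₀) ≤ (κ : EReal)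
  coarse_cocycle : ∀ (g h : G) (x : M), |σ (g * h) x - (σ g (h • x) + σ h x)| ≤ κ

/-- Properness of `σ`: `σ(γₙ, γₙ⁺) → +∞` for all sequences of distinct loxodromic elements with
`liminf d(γₙ⁻, γₙ⁺) > 0`, where `d` is any compatible metric. -/
def IsProperCocycle {G : Type u} {M : Type v} [Group G] [MulAction G M] [TopologicalSpace M]
    (σ : G → M → ℝ) : Prop :=
  ∀ d : MetricSpace (GroupUnion G M), IsCompatibleMetric d →
    ∀ (γ : ℕ → G) (a b : ℕ → M), Function.Injective γ →
      (∀ n, IsLoxodromic (γ n) (a n) (b n)) →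
      (∃ ε > 0, ∀ᶠ n in atTop,
        ε ≤ dist (GroupUnion.pt (b n) : GroupUnion G M) (GroupUnion.pt (a n))) →
      Tendsto (fun n => σ (γ n) (a n)) atTop atTop

/-- `σ` is an expanding coarse-cocycle, and `N` is a choice of its magnitude `‖·‖_σ`. -/
structure IsExpandingWithMagnitude {G : Type u} {M : Type v} [Group G] [MulAction G M]
    [TopologicalSpace M] (σ : G → M → ℝ) (N : G → ℝ) : Prop where
  cocycle : ∃ κ, IsCoarseCocycle κ σ
  proper : IsProperCocycle σ
  magnitude : ∀ d : MetricSpace (GroupUnion G M), IsCompatibleMetric d →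
    ∀ ε > 0, ∃ C > 0, ∀ (g : G) (x : M),
      ε < dist (GroupUnion.pt x : GroupUnion G M) (GroupUnion.elt g⁻¹) →
        N g - C ≤ σ g x ∧ σ g x ≤ N g + C

/-- `M⁽²⁾`, the space of ordered pairs of distinct points. -/
abbrev DistinctPairs (M : Type v) : Type v := {p : M × M // p.1 ≠ p.2}

/-- The diagonal action on `M⁽²⁾`. -/
def DistinctPairs.act {G : Type u} {M : Type v} [Group G] [MulAction G M] (g : G)
    (p : DistinctPairs M) : DistinctPairs M :=
  ⟨(g • p.1.1, g • p.1.2), (MulAction.injective g).ne p.2⟩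

/-- `κ`-coarse Gromov–Patterson–Sullivan systems of a non-elementary convergence group. -/
structure IsCoarseGPSSystem {G : Type u} {M : Type v} [Group G] [MulAction G M]
    [TopologicalSpace M] (κ : ℝ) (σ σbar : G → M → ℝ) (gp : DistinctPairs M → ℝ) : Prop where
  convergence : IsConvergenceGroup G M
  nonelementary : IsNonElementary G M
  cocycle : IsCoarseCocycle κ σ
  proper : IsProperCocycle σ
  cocycle_bar : IsCoarseCocycle κ σbar
  proper_bar : IsProperCocycle σbar
  locally_bounded : ∀ p : DistinctPairs M, ∃ U ∈ 𝓝 p, ∃ C : ℝ, ∀ q ∈ U, |gp q| ≤ C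
  coarse_identity : ∀ (g : G) (p : DistinctPairs M),
    |(σbar g p.1.1 + σ g p.1.2) - (gp (p.act g) - gp p)| ≤ κ

/-! ## Coarsely additive potentials -/

/-- Coarsely additive potentials. -/
structure IsCoarselyAdditivePotential {X : Type u} [MetricSpace X] (ψ : X → X → ℝ) : Prop where
  /-- `inf_{d(p,q) ≥ r} ψ(p,q) → +∞` as `r → ∞` -/
  proper : ∀ A : ℝ, ∃ r : ℝ, ∀ p q : X, r ≤ dist p q → A ≤ ψ p q
  bounded : ∀ r > 0, ∃ C : ℝ, ∀ p q : X, dist p q ≤ r → |ψ p q| ≤ C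
  additive : ∀ r > 0, ∃ κ > 0, ∀ (p q u : X) (c : ℝ → X), IsGeodesicSegment c p q →
    (∃ t ∈ Icc (0 : ℝ) (dist p q), dist u (c t) < r) →
    |ψ p q - (ψ p u + ψ u q)| ≤ κ

/-- `σ_ψ(γ, x) = limsup_{p → x} ψ(γ⁻¹o, p) - ψ(o, p)`. -/
def potentialCocycle {X : Type u} [MetricSpace X] {Γ : Subgroup (X ≃ᵢ X)} (ψ : X → X → ℝ)
    (o : X) (γ : Γ) (x : GromovBoundary X) : EReal :=
  limsup (fun p => ((ψ ((γ⁻¹ : Γ).1 o) p - ψ o p : ℝ) : EReal)) (towards x)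

/-- `σ̄_ψ(γ, x) = limsup_{p → x} ψ(p, γ⁻¹o) - ψ(p, o)`. -/
def potentialCocycleBar {X : Type u} [MetricSpace X] {Γ : Subgroup (X ≃ᵢ X)} (ψ : X → X → ℝ)
    (o : X) (γ : Γ) (x : GromovBoundary X) : EReal :=
  limsup (fun p => ((ψ p ((γ⁻¹ : Γ).1 o) - ψ p o : ℝ) : EReal)) (towards x)

/-- `G_ψ(x, y) = limsup_{p → x, q → y} ψ(p, o) + ψ(o, q) - ψ(p, q)`, for `x ≠ y`. -/
def potentialGromovProd {X : Type u} [MetricSpace X] (ψ : X → X → ℝ) (o : X)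
    (z : DistinctPairs (GromovBoundary X)) : EReal :=
  limsup (fun w : X × X => ((ψ w.1 o + ψ o w.2 - ψ w.1 w.2 : ℝ) : EReal))
    (towards z.1.1 ×ˢ towards z.1.2)

end

/-! ## Gromov products of points -/

section GromovProduct

variable {X : Type u} [MetricSpace X]

/-! Coarse additivity says that `ψ p q` splits, up to a bounded error, as `ψ p u + ψ u q` at every
`u` whose Gromov product `(p|q)_u` is bounded (`exists_additive`). If `p` and `p'` are both close to
a boundary point, the geodesics from `o` and from `o'` to `p` and `p'` pass near a common point
(`exists_branch_point`), and splitting there shows that `ψ o' p - ψ o p` and `ψ o' p' - ψ o p'`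
differ by at most a uniform constant (`exists_osc_bound`). So each limsup is finite and is uniformly
close to the value at any single point of `X` near the boundary points in question. The cocycle
relation and the GPS identity hold exactly on `X` by invariance of `ψ`, and pass to the boundary
with bounded error. The lower bound on the Gromov product comes from splitting at the centre of a
triangle. If `x` stays away from `γ⁻¹ o`, then `o` is near the geodesics from `γ⁻¹ o` towards `x`,
so `σ_ψ(γ, x)` is close to `ψ(γ⁻¹ o, o) = ψ(o, γ o)`.

The dynamics are expressed by `Near`, a Gromov product bound that is transitive up to `δ`. It
describes the neighbourhoods of boundary points and yields a metrizable uniform structure on `Γ ⊔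
∂X`. Since `(p|g⁻¹o)_o + (gp|go)_o = d(o, go)`, a point not near `g⁻¹ o` is sent near `g o` when
`d(o, go)` is large; with discreteness and properness of `X` this gives compactness and the
convergence property.

Two facts handle an arbitrary compatible metric. A collapsing sequence of distinct elements
converges to its attracting point (`IsCompatibleMetric.tendsto_elt`), so distance from `γ⁻¹`
prevents nearness to `γ⁻¹ o`; this gives the magnitude estimate. For loxodromic elements with
separated fixed points, the attracting points stay away from the collapsing sequence's repelling
point (`CollapsesTo.ne_of_isLoxodromic`), so the same comparison with `ψ` gives properness. -/

theorem gromovProd_comm (o p q : X) : gromovProd o p q = gromovProd o q p := by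
  simp only [gromovProd, dist_comm p q]; ring

theorem gromovProd_le_dist_left (o p q : X) : gromovProd o p q ≤ dist o p := by
  have := dist_triangle o p q
  unfold gromovProd; linarith

theorem gromovProd_le_dist_right (o p q : X) : gromovProd o p q ≤ dist o q := by
  rw [gromovProd_comm]; exact gromovProd_le_dist_left o q p

theorem gromovProd_le_add_dist_base (o o' p q : X) :
    gromovProd o p q ≤ gromovProd o' p q + dist o o' := by
  have h1 := dist_triangle o o' p
  have h2 := dist_triangle o o' q
  unfold gromovProd; linarith

theorem gromovProd_le_add_dist (o p p' q : X) :
    gromovProd o p q ≤ gromovProd o p' q + dist p p' := by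
  have h1 := dist_triangle o p' p
  have h2 := dist_triangle p' p q
  rw [dist_comm p' p] at h1 h2
  unfold gromovProd; linarith

theorem gromovProd_le_dist_of_between {p q a : X} (u : X)
    (h : dist p a + dist a q = dist p q) : gromovProd u p q ≤ dist u a := by
  have h1 := dist_triangle u a p
  have h2 := dist_triangle u a q
  rw [dist_comm a p] at h1
  unfold gromovProd; linarith

theorem gromovProd_map (g : X ≃ᵢ X) (o p q : X) :
    gromovProd (g o) (g p) (g q) = gromovProd o p q := by
  simp [gromovProd, g.isometry.dist_eq]

/-- The Gromov products of `p` with `γ⁻¹ o` and of `γ p` with `γ o` add up to `d(o, γ o)`. -/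
theorem gromovProd_add_map (g : X ≃ᵢ X) (o p : X) :
    gromovProd o p (g⁻¹ o) + gromovProd o (g p) (g o) = dist o (g o) := by
  have e : g (g⁻¹ o) = o := by rw [← IsometryEquiv.mul_apply]; simp
  have h1 : dist p (g⁻¹ o) = dist o (g p) := by
    rw [← g.isometry.dist_eq, e, dist_comm]
  have h2 : dist o (g⁻¹ o) = dist o (g o) := by
    rw [← g.isometry.dist_eq, e, dist_comm]
  have h3 : dist (g p) (g o) = dist o p := by rw [g.isometry.dist_eq, dist_comm]
  unfold gromovProd
  rw [h1, h2, h3]; ring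

theorem IsGeodesicSegment.between {c : ℝ → X} {p q : X} (h : IsGeodesicSegment c p q) {t : ℝ}
    (ht : t ∈ Icc (0 : ℝ) (dist p q)) : dist p (c t) + dist (c t) q = dist p q := by
  obtain ⟨h0, h1, h2⟩ := h
  have a := h2 0 ⟨le_rfl, dist_nonneg⟩ t ht
  have b := h2 t ht (dist p q) ⟨dist_nonneg, le_rfl⟩
  rw [h0, zero_sub, abs_neg, abs_of_nonneg ht.1] at a
  rw [h1, abs_sub_comm, abs_of_nonneg (sub_nonneg.2 ht.2)] at b
  rw [a, b]; ring

theorem IsGeodesicSegment.dist_left {c : ℝ → X} {p q : X} (h : IsGeodesicSegment c p q) {t : ℝ}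
    (ht : t ∈ Icc (0 : ℝ) (dist p q)) : dist p (c t) = t := by
  obtain ⟨h0, h1, h2⟩ := h
  have a := h2 0 ⟨le_rfl, dist_nonneg⟩ t ht
  rwa [h0, zero_sub, abs_neg, abs_of_nonneg ht.1] at a

theorem IsGeodesicSegment.continuousOn {c : ℝ → X} {p q : X} (h : IsGeodesicSegment c p q) :
    ContinuousOn c (Icc (0 : ℝ) (dist p q)) := by
  have : LipschitzOnWith 1 c (Icc (0 : ℝ) (dist p q)) := by
    refine LipschitzOnWith.of_dist_le_mul fun s hs t ht => ?_
    rw [h.2.2 s hs t ht, Real.dist_eq]; simp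
  exact this.continuousOn

/-- The consequences of Gromov hyperbolicity that are used below, with one constant: the
four-point inequality, and the existence of almost central points on geodesics. -/
structure HyperbolicWith (X : Type u) [MetricSpace X] (δ : ℝ) : Prop where
  nonneg : 0 ≤ δ
  four_point : ∀ o x y z : X,
    gromovProd o x y ≤ gromovProd o x z + δ ∨ gromovProd o y z ≤ gromovProd o x z + δ
  center : ∀ o p q : X, ∃ (c : ℝ → X) (t : ℝ), IsGeodesicSegment c p q ∧
    t ∈ Icc (0 : ℝ) (dist p q) ∧ dist o (c t) ≤ gromovProd o p q + δ ∧
    gromovProd (c t) p o ≤ δ ∧ gromovProd (c t) o q ≤ δ ∧ gromovProd (c t) p q ≤ δ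
  between : ∀ (p q : X) (t : ℝ), t ∈ Icc (0 : ℝ) (dist p q) →
    ∃ u, dist p u = t ∧ dist u q = dist p q - t

theorem exists_hyperbolicWith (hgeod : IsGeodesicSpace X) (hhyp : IsGromovHyperbolic X) :
    ∃ δ, HyperbolicWith X δ := by
  obtain ⟨δ₀, hδ⟩ := hhyp
  set D : ℝ := max δ₀ 0 + 1 with hD
  have hD1 : δ₀ < D := by have := le_max_left δ₀ 0; linarith
  have hD0 : 0 < D := by have := le_max_right δ₀ 0; linarith
  -- By the intermediate value theorem some point of the side `p q` is equidistant from the two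
  -- other sides; slimness bounds one distance, hence both. The extra `1` in `D` makes the bound
  -- strict, so that it is realised by actual points of the sides.
  have key : ∀ o p q : X, ∀ c : ℝ → X, IsGeodesicSegment c p q → ∃ t : ℝ,
      t ∈ Icc (0 : ℝ) (dist p q) ∧ gromovProd (c t) p o ≤ D ∧ gromovProd (c t) o q ≤ D := by
    intro o p q c hc
    obtain ⟨c₂, hc₂⟩ := hgeod p o
    obtain ⟨c₃, hc₃⟩ := hgeod o q
    set A := c₂ '' Icc 0 (dist p o) with hA
    set B := c₃ '' Icc 0 (dist o q) with hB
    have hAne : A.Nonempty := ⟨c₂ 0, 0, ⟨le_rfl, dist_nonneg⟩, rfl⟩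
    have hBne : B.Nonempty := ⟨c₃ 0, 0, ⟨le_rfl, dist_nonneg⟩, rfl⟩
    have hcont : ContinuousOn (fun s => Metric.infDist (c s) A - Metric.infDist (c s) B)
        (Icc 0 (dist p q)) :=
      ((Metric.continuous_infDist_pt A).comp_continuousOn hc.continuousOn).sub
        ((Metric.continuous_infDist_pt B).comp_continuousOn hc.continuousOn)
    have hpA : Metric.infDist (c 0) A = 0 :=
      Metric.infDist_zero_of_mem ⟨0, ⟨le_rfl, dist_nonneg⟩, by rw [hc₂.1, hc.1]⟩
    have hqB : Metric.infDist (c (dist p q)) B = 0 :=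
      Metric.infDist_zero_of_mem ⟨dist o q, ⟨dist_nonneg, le_rfl⟩, by rw [hc₃.2.1, hc.2.1]⟩
    obtain ⟨t, ht, hteq⟩ := intermediate_value_Icc (dist_nonneg : 0 ≤ dist p q) hcont
      (show (0 : ℝ) ∈ Icc _ _ by
        constructor
        · simp only [hpA]; linarith [Metric.infDist_nonneg (x := c 0) (s := B)]
        · simp only [hqB]; linarith [Metric.infDist_nonneg (x := c (dist p q)) (s := A)])
    have hboth : Metric.infDist (c t) A < D ∧ Metric.infDist (c t) B < D := by
      have hteq' : Metric.infDist (c t) A = Metric.infDist (c t) B := sub_eq_zero.1 hteq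
      rcases hδ p q o c c₂ c₃ hc hc₂ hc₃ t ht with ⟨s, hs, hd⟩ | ⟨s, hs, hd⟩
      · have : Metric.infDist (c t) A ≤ dist (c t) (c₂ s) :=
          Metric.infDist_le_dist_of_mem ⟨s, hs, rfl⟩
        constructor <;> linarith
      · have : Metric.infDist (c t) B ≤ dist (c t) (c₃ s) :=
          Metric.infDist_le_dist_of_mem ⟨s, hs, rfl⟩
        constructor <;> linarith
    obtain ⟨_, ⟨s, hs, rfl⟩, hsd⟩ := (Metric.infDist_lt_iff hAne).1 hboth.1
    obtain ⟨_, ⟨s', hs', rfl⟩, hsd'⟩ := (Metric.infDist_lt_iff hBne).1 hboth.2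
    exact ⟨t, ht, (gromovProd_le_dist_of_between _ (hc₂.between hs)).trans hsd.le,
      (gromovProd_le_dist_of_between _ (hc₃.between hs')).trans hsd'.le⟩
  have hclose : ∀ o p q u : X, dist p u + dist u q = dist p q → gromovProd u p o ≤ D →
      gromovProd u o q ≤ D → dist o u ≤ gromovProd o p q + 2 * D := by
    intro o p q u h h1 h2
    unfold gromovProd at *
    rw [dist_comm u p, dist_comm p o] at h1
    rw [dist_comm u o] at h1 h2
    linarith
  -- `2 * D` is the cost of `hclose`, and one more `D` that of passing from the central point to a
  -- neighbouring side.
  refine ⟨3 * D, by positivity, ?_, ?_, ?_⟩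
  · intro o x y z
    obtain ⟨c, hc⟩ := hgeod x z
    obtain ⟨c₂, hc₂⟩ := hgeod x y
    obtain ⟨c₃, hc₃⟩ := hgeod y z
    obtain ⟨t, ht, h1, h2⟩ := key o x z c hc
    have h3 := hclose o x z (c t) (hc.between ht) h1 h2
    rcases hδ x z y c c₂ c₃ hc hc₂ hc₃ t ht with ⟨s, hs, hd⟩ | ⟨s, hs, hd⟩
    · left
      have := gromovProd_le_dist_of_between o (hc₂.between hs)
      have := dist_triangle o (c t) (c₂ s)
      linarith
    · right
      have := gromovProd_le_dist_of_between o (hc₃.between hs)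
      have := dist_triangle o (c t) (c₃ s)
      linarith
  · intro o p q
    obtain ⟨c, hc⟩ := hgeod p q
    obtain ⟨t, ht, h1, h2⟩ := key o p q c hc
    refine ⟨c, t, hc, ht, ?_, by linarith, by linarith, ?_⟩
    · have := hclose o p q (c t) (hc.between ht) h1 h2
      linarith
    · have := gromovProd_le_dist_of_between (c t) (hc.between ht)
      rw [dist_self] at this
      linarith
  · intro p q t ht
    obtain ⟨c, hc⟩ := hgeod p q
    refine ⟨c t, hc.dist_left ht, ?_⟩
    have := hc.between ht
    rw [hc.dist_left ht] at this
    linarith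

variable {δ : ℝ}

theorem HyperbolicWith.le_of_le (H : HyperbolicWith X δ) {o x y z : X} {R : ℝ}
    (h : R ≤ gromovProd o x y) (h' : R ≤ gromovProd o y z) : R - δ ≤ gromovProd o x z := by
  rcases H.four_point o x y z with h1 | h1 <;> linarith

/-- If `p` and `p'` are much closer to each other than to `o'`, as seen from `o`, then the
geodesics from `o` and `o'` to `p` and `p'` all pass near a common point. -/
theorem HyperbolicWith.exists_branch_point (H : HyperbolicWith X δ) {o o' p p' : X}
    (h : gromovProd o p o' + (4 * δ + 2) ≤ gromovProd o p p') :
    ∃ u, gromovProd u o p ≤ 2 * δ ∧ gromovProd u o p' ≤ 2 * δ ∧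
      gromovProd u o' p ≤ 2 * δ ∧ gromovProd u o' p' ≤ 2 * δ := by
  have hδ := H.nonneg
  have hnn : 0 ≤ gromovProd o p o' := by
    have := dist_triangle p o o'
    rw [dist_comm p o] at this
    unfold gromovProd; linarith
  -- The point `u` on the way from `o` to `p` is placed more than `2 * δ` past where `o'` branches
  -- off and more than `δ` before where `p'` does. This margin excludes the wrong alternative in
  -- each use of the four-point inequality.
  set T := gromovProd o p o' + (3 * δ + 1) with hT
  have hTle : T ≤ dist o p := by have := gromovProd_le_dist_left o p p'; linarith
  obtain ⟨u, hu1, hu2⟩ := H.between o p T ⟨by linarith, hTle⟩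
  have e1 : gromovProd u o p = 0 := by
    unfold gromovProd; rw [dist_comm u o, hu1, hu2]; ring
  have e2 : gromovProd o p u = T := by
    unfold gromovProd; rw [hu1, dist_comm p u, hu2]; ring
  have e3 : gromovProd o p p' - T ≤ gromovProd u p p' := by
    have := dist_triangle o u p'
    unfold gromovProd; rw [hu2]; linarith
  have e4 : gromovProd u o o' + gromovProd o u o' = T := by
    unfold gromovProd; rw [dist_comm u o, hu1]; ring
  have e5 : gromovProd o u o' ≤ gromovProd o p o' + δ := by
    rcases H.four_point o p u o' with h1 | h1
    · linarith
    · exact h1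
  have f1 : gromovProd u o p' ≤ δ := by
    rcases H.four_point u o p' p with h1 | h1
    · linarith
    · rw [gromovProd_comm u p' p] at h1; linarith
  have f2 : gromovProd u o' p ≤ δ := by
    rcases H.four_point u o o' p with h1 | h1 <;> linarith
  have f3 : gromovProd u o' p' ≤ 2 * δ := by
    rcases H.four_point u o o' p' with h1 | h1 <;> linarith
  exact ⟨u, by linarith, by linarith, by linarith, f3⟩

end GromovProduct

/-! ## Coarsely additive potentials -/

namespace IsCoarselyAdditivePotential

variable {X : Type u} [MetricSpace X] {ψ : X → X → ℝ} {δ : ℝ}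

theorem exists_lower_bound (hψ : IsCoarselyAdditivePotential ψ) : ∃ m : ℝ, ∀ p q, m ≤ ψ p q := by
  obtain ⟨r, hr⟩ := hψ.proper 0
  obtain ⟨C, hC⟩ := hψ.bounded (max r 1) (by positivity)
  refine ⟨min 0 (-C), fun p q => ?_⟩
  rcases le_total r (dist p q) with h | h
  · exact (min_le_left _ _).trans (hr p q h)
  · exact (min_le_right _ _).trans (abs_le.1 (hC p q (h.trans (le_max_left _ _)))).1

/-- A point `u` with `(p|q)_u ≤ R` is within `R + δ` of some geodesic from `p` to `q`, so additivity
can be used without mentioning geodesics. -/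
theorem exists_additive (hψ : IsCoarselyAdditivePotential ψ) (H : HyperbolicWith X δ) (R : ℝ) :
    ∃ κ > 0, ∀ p q u : X, gromovProd u p q ≤ R → |ψ p q - (ψ p u + ψ u q)| ≤ κ := by
  obtain ⟨κ, hκ, h⟩ := hψ.additive (max (R + δ) 0 + 1) (by positivity)
  refine ⟨κ, hκ, fun p q u hu => ?_⟩
  obtain ⟨c, t, hc, ht, hd, -⟩ := H.center u p q
  refine h p q u c hc ⟨t, ht, ?_⟩
  have := le_max_left (R + δ) 0
  linarith

/-- The differences `ψ o' p - ψ o p` vary by a bounded amount only as `p` tends to infinity. -/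
theorem exists_osc_bound (hψ : IsCoarselyAdditivePotential ψ) (H : HyperbolicWith X δ) :
    ∃ κ > 0, ∀ o o' p p' : X, gromovProd o p o' + (4 * δ + 2) ≤ gromovProd o p p' →
      |(ψ o' p - ψ o p) - (ψ o' p' - ψ o p')| ≤ κ ∧
      |(ψ p o' - ψ p o) - (ψ p' o' - ψ p' o)| ≤ κ := by
  obtain ⟨κ, hκ, h⟩ := hψ.exists_additive H (2 * δ)
  -- All four values of `ψ` split at the branch point, where the main terms cancel; each splitting
  -- costs `κ`.
  refine ⟨4 * κ, by positivity, fun o o' p p' hp => ?_⟩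
  obtain ⟨u, h1, h2, h3, h4⟩ := H.exists_branch_point hp
  have a1 := abs_le.1 (h _ _ _ h1)
  have a2 := abs_le.1 (h _ _ _ h2)
  have a3 := abs_le.1 (h _ _ _ h3)
  have a4 := abs_le.1 (h _ _ _ h4)
  rw [gromovProd_comm] at h1 h2 h3 h4
  have b1 := abs_le.1 (h _ _ _ h1)
  have b2 := abs_le.1 (h _ _ _ h2)
  have b3 := abs_le.1 (h _ _ _ h3)
  have b4 := abs_le.1 (h _ _ _ h4)
  constructor <;> rw [abs_le] <;> constructor <;> linarith

/-- Splitting all three terms at a central point `u` of the triangle leaves `ψ u o + ψ o u`, which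
is bounded below. -/
theorem exists_prod_lower_bound (hψ : IsCoarselyAdditivePotential ψ) (H : HyperbolicWith X δ) :
    ∃ m : ℝ, ∀ o p q : X, m ≤ ψ p o + ψ o q - ψ p q := by
  obtain ⟨κ, hκ, h⟩ := hψ.exists_additive H δ
  obtain ⟨m, hm⟩ := hψ.exists_lower_bound
  refine ⟨2 * m - 3 * κ, fun o p q => ?_⟩
  obtain ⟨c, t, -, -, -, h1, h2, h3⟩ := H.center o p q
  have a1 := abs_le.1 (h _ _ _ h1)
  have a2 := abs_le.1 (h _ _ _ h2)
  have a3 := abs_le.1 (h _ _ _ h3)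
  have := hm (c t) o
  have := hm o (c t)
  linarith

end IsCoarselyAdditivePotential

/-! ## Nearness in the bordification -/

section Near

variable {X : Type u} [MetricSpace X] {δ : ℝ}

namespace GromovBordification

theorem reps_nonempty (z : GromovBordification X) : z.reps.Nonempty := by
  rcases z with p | ξ
  · exact ⟨_, rfl⟩
  · obtain ⟨r, hr⟩ := Quotient.exists_rep ξ
    exact ⟨r.1, r, hr, rfl⟩

/-- The action of an isometry on `X ⊔ ∂X`. -/
def map (g : X ≃ᵢ X) : GromovBordification X → GromovBordification X
  | .of p => .of (g p)
  | .bdry ξ => .bdry (g • ξ)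

theorem map_inv_map (g : X ≃ᵢ X) (z : GromovBordification X) : map g⁻¹ (map g z) = z := by
  rcases z with p | ξ
  · simp only [map]
    rw [← IsometryEquiv.mul_apply, inv_mul_cancel]; rfl
  · simp [map]

theorem comp_mem_reps_map (g : X ≃ᵢ X) {z : GromovBordification X} {c : ℝ≥0 → X}
    (hc : c ∈ z.reps) : (fun t => g (c t)) ∈ (map g z).reps := by
  rcases z with p | ξ
  · rw [show c = fun _ => p from hc]; rfl
  · obtain ⟨r, hr, rfl⟩ := hc
    exact ⟨r.map g, by rw [← hr]; rfl, rfl⟩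

end GromovBordification

open GromovBordification

/-- All representatives of `z` and `w` have eventually Gromov product at least `R`. -/
def Near (o : X) (R : ℝ) (z w : GromovBordification X) : Prop :=
  ∀ c ∈ z.reps, ∀ c' ∈ w.reps, ∀ᶠ q : ℝ≥0 × ℝ≥0 in atTop, R ≤ gromovProd o (c q.1) (c' q.2)

theorem Near.mono {o : X} {R S : ℝ} {z w : GromovBordification X} (h : Near o R z w)
    (hS : S ≤ R) : Near o S z w :=
  fun c hc c' hc' => (h c hc c' hc').mono fun _ hq => hS.trans hq

theorem Near.symm {o : X} {R : ℝ} {z w : GromovBordification X} (h : Near o R z w) :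
    Near o R w z := by
  intro c hc c' hc'
  have h1 := h c' hc' c hc
  obtain ⟨a, ha⟩ := eventually_atTop.1 h1
  refine eventually_atTop.2 ⟨a.swap, fun b hb => ?_⟩
  rw [gromovProd_comm]
  exact ha b.swap ⟨hb.2, hb.1⟩

theorem Near.trans (H : HyperbolicWith X δ) {o : X} {R : ℝ} {z w v : GromovBordification X}
    (h : Near o R z w) (h' : Near o R w v) : Near o (R - δ) z v := by
  intro c hc c' hc'
  obtain ⟨m, hm⟩ := reps_nonempty w
  obtain ⟨a, ha⟩ := eventually_atTop.1 (h c hc m hm)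
  obtain ⟨b, hb⟩ := eventually_atTop.1 (h' m hm c' hc')
  refine eventually_atTop.2 ⟨(a.1, b.2), fun q hq => ?_⟩
  exact H.le_of_le (ha (q.1, max a.2 b.1) ⟨hq.1, le_max_left _ _⟩)
    (hb (max a.2 b.1, q.2) ⟨le_max_right _ _, hq.2⟩)

theorem Near.base {o : X} (o' : X) {R : ℝ} {z w : GromovBordification X} (h : Near o R z w) :
    Near o' (R - dist o o') z w := by
  intro c hc c' hc'
  filter_upwards [h c hc c' hc'] with q hq
  have := gromovProd_le_add_dist_base o o' (c q.1) (c' q.2)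
  linarith

theorem Near.map {o : X} {R : ℝ} {z w : GromovBordification X} (h : Near o R z w)
    (g : X ≃ᵢ X) : Near (g o) R (map g z) (map g w) := by
  intro c hc c' hc'
  have h1 := comp_mem_reps_map g⁻¹ hc
  have h2 := comp_mem_reps_map g⁻¹ hc'
  rw [map_inv_map] at h1 h2
  filter_upwards [h _ h1 _ h2] with q hq
  rw [← gromovProd_map g] at hq
  simpa only [← IsometryEquiv.mul_apply, mul_inv_cancel, IsometryEquiv.coe_one, id] using hq

/-- Isometries act coarsely continuously. -/
theorem Near.map_base {o : X} {R : ℝ} {z w : GromovBordification X} (h : Near o R z w)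
    (g : X ≃ᵢ X) : Near o (R - dist o (g o)) (GromovBordification.map g z)
      (GromovBordification.map g w) := by
  have := (h.map g).base o
  rwa [dist_comm] at this

theorem near_of_iff {o p q : X} {R : ℝ} : Near o R (of p) (of q) ↔ R ≤ gromovProd o p q := by
  constructor
  · intro h
    exact (h _ rfl _ rfl).exists.choose_spec
  · rintro h c rfl c' rfl
    exact Eventually.of_forall fun _ => h

theorem Near.le_dist {o p : X} {R : ℝ} {w : GromovBordification X} (h : Near o R w (of p)) :
    R ≤ dist o p := by
  obtain ⟨c, hc⟩ := reps_nonempty w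
  obtain ⟨q, hq⟩ := (h c hc _ rfl).exists
  exact hq.trans (gromovProd_le_dist_right _ _ _)

theorem Near.of_dist {o p p' : X} {R : ℝ} {w : GromovBordification X} (h : Near o R w (of p)) :
    Near o (R - dist p p') w (of p') := by
  rintro c hc _ rfl
  filter_upwards [h c hc _ rfl] with q hq
  have := gromovProd_le_add_dist o p p' (c q.1)
  rw [gromovProd_comm o p, gromovProd_comm o p'] at this
  linarith

/-! ### Asymptotic rays and change of representatives. -/

theorem GeodesicRay.dist_eq (r : GeodesicRay X) (s t : ℝ≥0) :
    dist (r.1 s) (r.1 t) = |(s : ℝ) - t| := by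
  rw [r.2.dist_eq, NNReal.dist_eq]

/-- The points at times `s` and `s'` are within `C + |s - s'|` of each other, and `(s + s' - |s -
s'|) / 2` is the minimum of `s` and `s'`. -/
theorem GeodesicRay.exists_le_gromovProd {r r' : GeodesicRay X} (h : r.endpoint = r'.endpoint)
    (o : X) : ∃ D : ℝ, ∀ s s' : ℝ≥0, min (s : ℝ) s' - D ≤ gromovProd o (r.1 s) (r'.1 s') := by
  obtain ⟨C, hC⟩ : ∃ C : ℝ, ∀ t, dist (r.1 t) (r'.1 t) ≤ C := Quotient.exact h
  refine ⟨C + dist (r.1 0) o, fun s s' => ?_⟩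
  have h1 := gromovProd_le_add_dist_base (r.1 0) o (r.1 s) (r'.1 s')
  have h2 := r.dist_eq 0 s
  have h3 := r'.dist_eq 0 s'
  have h4 := r'.dist_eq s s'
  have h5 := dist_triangle (r'.1 0) (r.1 0) (r'.1 s')
  have h6 := dist_triangle (r.1 s) (r'.1 s) (r'.1 s')
  have h7 := hC 0
  have h8 := hC s
  rw [dist_comm] at h7
  simp only [NNReal.coe_zero, zero_sub, abs_neg, NNReal.abs_eq] at h2 h3
  have h9 : min (s : ℝ) s' = (s + s' - |(s : ℝ) - s'|) / 2 := by
    rcases le_total (s : ℝ) s' with h | h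
    · rw [min_eq_left h, abs_of_nonpos (by linarith)]; ring
    · rw [min_eq_right h, abs_of_nonneg (by linarith)]; ring
  unfold gromovProd at h1
  unfold gromovProd
  rw [h9]
  linarith

theorem HyperbolicWith.rep_change (H : HyperbolicWith X δ) {z : GromovBordification X}
    {c c' : ℝ≥0 → X} (hc : c ∈ z.reps) (hc' : c' ∈ z.reps) (o : X) (R : ℝ) :
    ∃ s₀, ∀ s ≥ s₀, ∀ s' ≥ s₀, ∀ y, R ≤ gromovProd o (c s) y → R - δ ≤ gromovProd o (c' s') y := by
  rcases z with p | ξ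
  · rw [show c = fun _ => p from hc, show c' = fun _ => p from hc']
    exact ⟨0, fun _ _ _ _ y hy => by linarith [H.nonneg]⟩
  · obtain ⟨r, hr, rfl⟩ := hc
    obtain ⟨r', hr', rfl⟩ := hc'
    obtain ⟨D, hD⟩ := GeodesicRay.exists_le_gromovProd (hr'.trans hr.symm) o
    refine ⟨Real.toNNReal (R + D), fun s hs s' hs' y hy => ?_⟩
    have a : R + D ≤ s := Real.toNNReal_le_iff_le_coe.1 hs
    have a' : R + D ≤ s' := Real.toNNReal_le_iff_le_coe.1 hs'
    refine H.le_of_le ?_ hy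
    have := hD s' s
    have : R + D ≤ min (s' : ℝ) s := le_min a' a
    linarith

/-- Replacing a representative on either side costs `δ`, because late points of asymptotic rays have
large Gromov product. Hence `Near` agrees with a bound on the extended Gromov product up to `2 * δ`.
-/
theorem HyperbolicWith.near_of_frequently (H : HyperbolicWith X δ) {o : X} {R : ℝ}
    {z w : GromovBordification X} {c c' : ℝ≥0 → X} (hc : c ∈ z.reps) (hc' : c' ∈ w.reps)
    (h : ∃ᶠ q : ℝ≥0 × ℝ≥0 in atTop, R ≤ gromovProd o (c q.1) (c' q.2)) :
    Near o (R - 2 * δ) z w := by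
  intro c₁ hc₁ c₁' hc₁'
  obtain ⟨s₀, hs₀⟩ := H.rep_change hc hc₁ o R
  obtain ⟨t₀, ht₀⟩ := H.rep_change hc' hc₁' o (R - δ)
  obtain ⟨q, hq, hqR⟩ := (frequently_atTop.1 h) (s₀, t₀)
  refine eventually_atTop.2 ⟨(s₀, t₀), fun b hb => ?_⟩
  have h1 := hs₀ q.1 hq.1 b.1 hb.1 _ hqR
  rw [gromovProd_comm] at h1
  have h2 := ht₀ q.2 hq.2 b.2 hb.2 _ h1
  rw [gromovProd_comm] at h2
  linarith

theorem HyperbolicWith.near_of_lt_ext (H : HyperbolicWith X δ) {o : X} {R : ℝ}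
    {z w : GromovBordification X} (h : (R : EReal) < extGromovProd o z w) :
    Near o (R - 2 * δ) z w := by
  simp only [extGromovProd, lt_iSup_iff] at h
  obtain ⟨c, hc, c', hc', h⟩ := h
  refine H.near_of_frequently hc hc' (Eventually.frequently ?_)
  have := eventually_lt_of_lt_liminf h
  rw [prod_atTop_atTop_eq] at this
  exact this.mono fun q hq => (EReal.coe_lt_coe_iff.1 hq).le

theorem Near.le_ext {o : X} {R : ℝ} {z w : GromovBordification X} (h : Near o R z w) :
    (R : EReal) ≤ extGromovProd o z w := by
  obtain ⟨c, hc⟩ := reps_nonempty z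
  obtain ⟨c', hc'⟩ := reps_nonempty w
  refine le_iSup₂_of_le c hc (le_iSup₂_of_le c' hc' (le_liminf_of_le (by isBoundedDefault) ?_))
  rw [prod_atTop_atTop_eq]
  exact (h c hc c' hc').mono fun q hq => EReal.coe_le_coe_iff.2 hq

theorem near_self (o : X) (R : ℝ) (ξ : GromovBoundary X) : Near o R (bdry ξ) (bdry ξ) := by
  rintro _ ⟨r, hr, rfl⟩ _ ⟨r', hr', rfl⟩
  obtain ⟨D, hD⟩ := GeodesicRay.exists_le_gromovProd (hr.trans hr'.symm) o
  refine eventually_atTop.2 ⟨(Real.toNNReal (R + D), Real.toNNReal (R + D)), fun q hq => ?_⟩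
  have a : R + D ≤ q.1 := Real.toNNReal_le_iff_le_coe.1 hq.1
  have a' : R + D ≤ q.2 := Real.toNNReal_le_iff_le_coe.1 hq.2
  have := hD q.1 q.2
  have : R + D ≤ min (q.1 : ℝ) q.2 := le_min a a'
  linarith

theorem HyperbolicWith.near_endpoint (H : HyperbolicWith X δ) (r : GeodesicRay X) (o : X)
    (R : ℝ) : ∃ t₀ : ℝ≥0, ∀ t ≥ t₀, Near o R (bdry r.endpoint) (of (r.1 t)) := by
  obtain ⟨D, hD⟩ := GeodesicRay.exists_le_gromovProd (rfl : r.endpoint = r.endpoint) o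
  refine ⟨Real.toNNReal (R + 2 * δ + D), fun t ht => ?_⟩
  have := H.near_of_frequently (o := o) (R := R + 2 * δ) (z := bdry r.endpoint)
    (w := of (r.1 t)) ⟨r, rfl, rfl⟩ rfl
    (Eventually.frequently (eventually_atTop.2 ⟨(t, 0), fun q hq => ?_⟩))
  · simpa using this
  · have a : R + 2 * δ + D ≤ t := Real.toNNReal_le_iff_le_coe.1 ht
    have b : (t : ℝ) ≤ q.1 := hq.1
    have h1 := hD q.1 t
    rw [min_eq_right b] at h1
    show _ ≤ gromovProd o (r.1 q.1) (r.1 t)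
    linarith

/-- Chaining `r t`, a late point of `r`, a late point of `r'` and `r' t` gives `(r t|r' t)_o ≥ t -
const`, which bounds the distance between the rays at time `t`. -/
theorem HyperbolicWith.eq_of_forall_near (H : HyperbolicWith X δ) {o : X}
    {ξ η : GromovBoundary X} (h : ∀ R, Near o R (bdry ξ) (bdry η)) : ξ = η := by
  obtain ⟨r, rfl⟩ := Quotient.exists_rep ξ
  obtain ⟨r', rfl⟩ := Quotient.exists_rep η
  refine Quotient.sound ?_
  obtain ⟨D, hD⟩ := GeodesicRay.exists_le_gromovProd (rfl : r.endpoint = r.endpoint) o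
  obtain ⟨D', hD'⟩ := GeodesicRay.exists_le_gromovProd (rfl : r'.endpoint = r'.endpoint) o
  refine ⟨dist o (r.1 0) + dist o (r'.1 0) + 2 * (|D| + |D'| + 2 * δ), fun t => ?_⟩
  obtain ⟨a, ha⟩ := eventually_atTop.1 (h t r.1 ⟨r, rfl, rfl⟩ r'.1 ⟨r', rfl, rfl⟩)
  have h0 := H.nonneg
  have h1 := ha (max a.1 t, max a.2 t) ⟨le_max_left _ _, le_max_left _ _⟩
  have h2 := hD t (max a.1 t)
  have h3 := hD' (max a.2 t) t
  rw [min_eq_left (by exact_mod_cast le_max_right _ _)] at h2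
  rw [min_eq_right (by exact_mod_cast le_max_right _ _)] at h3
  have hDa := le_abs_self D
  have hDa' := le_abs_self D'
  have hn := abs_nonneg D
  have hn' := abs_nonneg D'
  have h4 := H.le_of_le (R := t - |D| - |D'|) (by linarith) (h1.trans' (by linarith))
  have h5 := H.le_of_le (R := t - |D| - |D'| - δ) h4 (h3.trans' (by linarith))
  have h6 := dist_triangle o (r.1 0) (r.1 t)
  have h7 := dist_triangle o (r'.1 0) (r'.1 t)
  have h8 := r.dist_eq 0 t
  have h9 := r'.dist_eq 0 t
  simp only [NNReal.coe_zero, zero_sub, abs_neg, NNReal.abs_eq] at h8 h9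
  unfold gromovProd at h5
  linarith

/-- The two products in `gromovProd_add_map` have sum `d(o, g o)`, so a small one forces a large
one. This is the source of all convergence dynamics below. -/
theorem HyperbolicWith.near_map_of_not_near (H : HyperbolicWith X δ) {o : X} {R : ℝ}
    {w : GromovBordification X} (g : X ≃ᵢ X) (h : ¬ Near o R w (of (g⁻¹ o))) :
    Near o (dist o (g o) - R - 2 * δ) (map g w) (of (g o)) := by
  simp only [Near, not_forall] at h
  obtain ⟨c, hc, c', rfl, h⟩ := h
  refine H.near_of_frequently (comp_mem_reps_map g hc) rfl ?_
  refine (not_eventually.1 h).mono fun q hq => ?_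
  have := gromovProd_add_map g o (c q.1)
  linarith [not_le.1 hq]

/-! ### The topology near boundary points -/

theorem HyperbolicWith.mem_nhds_bdry_iff (H : HyperbolicWith X δ) (o : X) {ξ : GromovBoundary X}
    {S : Set (GromovBordification X)} :
    S ∈ 𝓝 (bdry ξ) ↔ ∃ R, ∀ z, Near o R (bdry ξ) z → z ∈ S := by
  constructor
  · intro h
    obtain ⟨U, hUS, hU, hξ⟩ := mem_nhds_iff.1 h
    obtain ⟨R, hR⟩ := hU.2 ξ hξ o
    refine ⟨R + 1, fun z hz => hUS (hR z (lt_of_lt_of_le ?_ hz.le_ext))⟩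
    exact EReal.coe_lt_coe_iff.2 (by linarith)
  · rintro ⟨R, hR⟩
    -- This is the set of points having `S` as a neighbourhood; near the boundary, its openness
    -- rests on the approximate transitivity of `Near`.
    refine mem_nhds_iff.2 ⟨{z | (∃ p, z = of p ∧ ∀ᶠ p' in 𝓝 p, of p' ∈ S) ∨
      ∃ η, z = bdry η ∧ ∃ T, ∀ w, Near o T (bdry η) w → w ∈ S}, ?_, ⟨?_, ?_⟩, ?_⟩
    · rintro z (⟨p, rfl, hp⟩ | ⟨η, rfl, T, hT⟩)
      · exact hp.self_of_nhds
      · exact hT _ (near_self o T η)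
    · have : {p : X | of p ∈ {z | (∃ p, z = of p ∧ ∀ᶠ p' in 𝓝 p, of p' ∈ S) ∨
          ∃ η, z = bdry η ∧ ∃ T, ∀ w, Near o T (bdry η) w → w ∈ S}} =
          {p | ∀ᶠ p' in 𝓝 p, of p' ∈ S} := by
        ext p; simp
      rw [this]
      exact isOpen_setOfPred_eventually_nhds
    · rintro η (⟨p, hp, -⟩ | ⟨η', hη, T, hT⟩) o'
      · cases hp
      · cases hη
        -- The terms pay, in order, for a unit ball around a point of `X`, for transitivity, for
        -- passing from the extended product to `Near`, and for the change of base point.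
        refine ⟨T + 1 + δ + 2 * δ + dist o' o, fun z hz => ?_⟩
        have hz' := (H.near_of_lt_ext hz).base o
        have h0 := H.nonneg
        rcases z with p | ζ
        · refine Or.inl ⟨p, rfl, ?_⟩
          filter_upwards [Metric.ball_mem_nhds p one_pos] with p' hp'
          rw [Metric.mem_ball, dist_comm] at hp'
          exact hT _ (hz'.of_dist.mono (by linarith))
        · refine Or.inr ⟨ζ, rfl, T + δ, fun w hw => hT w ?_⟩
          exact ((hz'.mono (by linarith)).trans H hw).mono (by linarith)
    · exact Or.inr ⟨ξ, rfl, R, hR⟩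

theorem HyperbolicWith.mem_towards_iff (H : HyperbolicWith X δ) (o : X) {ξ : GromovBoundary X}
    {S : Set X} : S ∈ towards ξ ↔ ∃ R, ∀ p, Near o R (bdry ξ) (of p) → p ∈ S := by
  rw [towards, mem_comap]
  constructor
  · rintro ⟨t, ht, hS⟩
    obtain ⟨R, hR⟩ := (H.mem_nhds_bdry_iff o).1 ht
    exact ⟨R, fun p hp => hS (hR _ hp)⟩
  · rintro ⟨R, hR⟩
    exact ⟨{z | Near o R (bdry ξ) z}, (H.mem_nhds_bdry_iff o).2 ⟨R, fun _ => id⟩, hR⟩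

theorem HyperbolicWith.mem_nhds_boundary_iff (H : HyperbolicWith X δ) (o : X)
    {ξ : GromovBoundary X} {S : Set (GromovBoundary X)} :
    S ∈ 𝓝 ξ ↔ ∃ R, ∀ η, Near o R (bdry ξ) (bdry η) → η ∈ S := by
  rw [nhds_induced, mem_comap]
  constructor
  · rintro ⟨t, ht, hS⟩
    obtain ⟨R, hR⟩ := (H.mem_nhds_bdry_iff o).1 ht
    exact ⟨R, fun p hp => hS (hR _ hp)⟩
  · rintro ⟨R, hR⟩
    exact ⟨{z | Near o R (bdry ξ) z}, (H.mem_nhds_bdry_iff o).2 ⟨R, fun _ => id⟩, hR⟩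

theorem HyperbolicWith.eventually_near (H : HyperbolicWith X δ) (o : X) (R : ℝ)
    (ξ : GromovBoundary X) : ∀ᶠ p in towards ξ, Near o R (bdry ξ) (of p) :=
  (H.mem_towards_iff o).2 ⟨R, fun _ => id⟩

theorem HyperbolicWith.eventually_nhds_near (H : HyperbolicWith X δ) (o : X) (R : ℝ)
    (ξ : GromovBoundary X) : ∀ᶠ η in 𝓝 ξ, Near o R (bdry ξ) (bdry η) :=
  (H.mem_nhds_boundary_iff o).2 ⟨R, fun _ => id⟩

theorem HyperbolicWith.towards_neBot (H : HyperbolicWith X δ) (ξ : GromovBoundary X) :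
    (towards ξ).NeBot := by
  obtain ⟨r, rfl⟩ := Quotient.exists_rep ξ
  refine forall_mem_nonempty_iff_neBot.1 fun S hS => ?_
  obtain ⟨R, hR⟩ := (H.mem_towards_iff (r.1 0)).1 hS
  obtain ⟨t, ht⟩ := H.near_endpoint r (r.1 0) R
  exact ⟨_, hR _ (ht t le_rfl)⟩

theorem HyperbolicWith.tendsto_towards (H : HyperbolicWith X δ) (g : X ≃ᵢ X)
    (ξ : GromovBoundary X) : Tendsto g (towards ξ) (towards (g • ξ)) := by
  intro S hS
  have : Nonempty X := by
    obtain ⟨r, -⟩ := Quotient.exists_rep ξ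
    exact ⟨r.1 0⟩
  obtain ⟨o⟩ := this
  obtain ⟨R, hR⟩ := (H.mem_towards_iff o).1 hS
  refine (H.mem_towards_iff o).2 ⟨R + dist o (g o), fun p hp => hR _ ?_⟩
  exact (hp.map_base g).mono (by linarith)

end Near

/-! ## The cocycles and the Gromov product of a potential -/

section Potential

/-- The limsup is squeezed between `f p - κ` and `f p + κ` for every `p ∈ S`. Through this,
estimates on the limsups become estimates at single points. -/
theorem EReal.limsup_coe_close {α : Type*} {F : Filter α} [F.NeBot] {f : α → ℝ} {κ : ℝ}
    {S : Set α} (hS : S ∈ F) (h : ∀ p ∈ S, ∀ p' ∈ S, |f p - f p'| ≤ κ) :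
    (limsup (fun p => (f p : EReal)) F ≠ ⊥ ∧ limsup (fun p => (f p : EReal)) F ≠ ⊤) ∧
      ∀ p ∈ S, |(limsup (fun p => (f p : EReal)) F).toReal - f p| ≤ κ := by
  have upper : ∀ p ∈ S, limsup (fun p => (f p : EReal)) F ≤ ((f p + κ : ℝ) : EReal) := by
    intro p hp
    refine limsup_le_of_le (by isBoundedDefault) ?_
    filter_upwards [hS] with p' hp'
    exact EReal.coe_le_coe_iff.2 (by linarith [(abs_le.1 (h p hp p' hp')).1])
  have lower : ∀ p ∈ S, ((f p - κ : ℝ) : EReal) ≤ limsup (fun p => (f p : EReal)) F := by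
    intro p hp
    refine le_limsup_of_frequently_le (Eventually.frequently ?_) (by isBoundedDefault)
    filter_upwards [hS] with p' hp'
    exact EReal.coe_le_coe_iff.2 (by linarith [(abs_le.1 (h p hp p' hp')).2])
  obtain ⟨p₀, hp₀⟩ := Filter.nonempty_of_mem hS
  have hbot : limsup (fun p => (f p : EReal)) F ≠ ⊥ :=
    ne_bot_of_le_ne_bot (EReal.coe_ne_bot _) (lower p₀ hp₀)
  have htop : limsup (fun p => (f p : EReal)) F ≠ ⊤ :=
    ne_top_of_le_ne_top (EReal.coe_ne_top _) (upper p₀ hp₀)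
  refine ⟨⟨hbot, htop⟩, fun p hp => ?_⟩
  have h1 := upper p hp
  have h2 := lower p hp
  rw [← EReal.coe_toReal htop hbot, EReal.coe_le_coe_iff] at h1 h2
  rw [abs_le]; constructor <;> linarith

variable {X : Type u} [MetricSpace X] {ψ : X → X → ℝ} {δ : ℝ}

open GromovBordification

namespace IsCoarselyAdditivePotential

/-- The product `(p|γ⁻¹o)_o` is at most `d(o, γ⁻¹o)`, so the nearness required here ensures the
hypothesis of `exists_osc_bound`. Only this threshold depends on `γ`; the error `κ` is uniform. -/
theorem exists_cocycle_approx (hψ : IsCoarselyAdditivePotential ψ) (H : HyperbolicWith X δ) :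
    ∃ κ > 0, ∀ (Γ : Subgroup (X ≃ᵢ X)) (o : X) (γ : Γ) (x : GromovBoundary X),
      ((potentialCocycle ψ o γ x ≠ ⊥ ∧ potentialCocycle ψ o γ x ≠ ⊤) ∧
        ∀ p, Near o (dist o ((γ⁻¹ : Γ).1 o) + 5 * δ + 2) (bdry x) (of p) →
          |(potentialCocycle ψ o γ x).toReal - (ψ ((γ⁻¹ : Γ).1 o) p - ψ o p)| ≤ κ) ∧
      (potentialCocycleBar ψ o γ x ≠ ⊥ ∧ potentialCocycleBar ψ o γ x ≠ ⊤) ∧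
        ∀ p, Near o (dist o ((γ⁻¹ : Γ).1 o) + 5 * δ + 2) (bdry x) (of p) →
          |(potentialCocycleBar ψ o γ x).toReal - (ψ p ((γ⁻¹ : Γ).1 o) - ψ p o)| ≤ κ := by
  obtain ⟨κ, hκ, h⟩ := hψ.exists_osc_bound H
  refine ⟨κ, hκ, fun Γ o γ x => ?_⟩
  have := H.towards_neBot x
  have key : ∀ p ∈ {p | Near o (dist o ((γ⁻¹ : Γ).1 o) + 5 * δ + 2) (bdry x) (of p)},
      ∀ p' ∈ {p | Near o (dist o ((γ⁻¹ : Γ).1 o) + 5 * δ + 2) (bdry x) (of p)},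
      gromovProd o p ((γ⁻¹ : Γ).1 o) + (4 * δ + 2) ≤ gromovProd o p p' := by
    intro p hp p' hp'
    have h1 := near_of_iff.1 (hp.symm.trans H hp')
    have h2 := gromovProd_le_dist_right o p ((γ⁻¹ : Γ).1 o)
    linarith
  exact ⟨EReal.limsup_coe_close (H.eventually_near o _ x)
      fun p hp p' hp' => (h _ _ _ _ (key p hp p' hp')).1,
    EReal.limsup_coe_close (H.eventually_near o _ x)
      fun p hp p' hp' => (h _ _ _ _ (key p hp p' hp')).2⟩

theorem exists_gromovProd_approx (hψ : IsCoarselyAdditivePotential ψ)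
    (H : HyperbolicWith X δ) :
    ∃ κ > 0, ∀ (o : X) (z : DistinctPairs (GromovBoundary X)) (R : ℝ),
      ¬ Near o R (bdry z.1.1) (bdry z.1.2) →
      (potentialGromovProd ψ o z ≠ ⊥ ∧ potentialGromovProd ψ o z ≠ ⊤) ∧
        ∀ w : X × X, w ∈ {p | Near o (R + 7 * δ + 2) (bdry z.1.1) (of p)} ×ˢ
            {p | Near o (R + 7 * δ + 2) (bdry z.1.2) (of p)} →
          |(potentialGromovProd ψ o z).toReal - (ψ w.1 o + ψ o w.2 - ψ w.1 w.2)| ≤ κ := by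
  obtain ⟨κ, hκ, h⟩ := hψ.exists_osc_bound H
  have hδ := H.nonneg
  refine ⟨2 * κ, by positivity, fun o z R hz => ?_⟩
  have := H.towards_neBot z.1.1
  have := H.towards_neBot z.1.2
  refine EReal.limsup_coe_close
    (prod_mem_prod (H.eventually_near o _ z.1.1) (H.eventually_near o _ z.1.2)) ?_
  rintro ⟨p, q⟩ ⟨hp, hq⟩ ⟨p', q'⟩ ⟨hp', hq'⟩
  simp only [mem_ofPred_eq] at hp hq hp' hq' ⊢
  -- Of the margin `7 * δ + 2`, this bound uses `2 * δ`, the hypothesis of `exists_osc_bound` uses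
  -- `4 * δ + 2`, and transitivity uses `δ`. The points `p` and `q` are then varied one at a time.
  have far : ∀ a b : X, Near o (R + 7 * δ + 2) (bdry z.1.1) (of a) →
      Near o (R + 7 * δ + 2) (bdry z.1.2) (of b) → gromovProd o a b ≤ R + 2 * δ := by
    intro a b ha hb
    by_contra! hab
    refine hz ?_
    have h1 : Near o (R + 2 * δ) (of a) (of b) := near_of_iff.2 hab.le
    have h2 := (ha.mono (by linarith : R + 2 * δ ≤ _)).trans H h1
    exact (h2.trans H (hb.symm.mono (by linarith))).mono (by linarith)
  have hpp := near_of_iff.1 (hp.symm.trans H hp')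
  have hqq := near_of_iff.1 (hq.symm.trans H hq')
  have f1 := far p q hp hq
  have f2 := far p' q hp' hq
  rw [gromovProd_comm] at f2
  have a1 := abs_le.1 (h o q p p' (by linarith)).2
  have a2 := abs_le.1 (h o p' q q' (by linarith)).1
  rw [abs_le]; constructor <;> linarith

end IsCoarselyAdditivePotential

theorem HyperbolicWith.exists_not_near (H : HyperbolicWith X δ) (o : X) {x y : GromovBoundary X}
    (h : x ≠ y) : ∃ R, ¬ Near o R (bdry x) (bdry y) := by
  by_contra! h'
  exact h (H.eq_of_forall_near h')

theorem IsCoarseCocycle.mono {G : Type u} {M : Type v} [Group G] [MulAction G M]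
    [TopologicalSpace M] {κ κ' : ℝ} {σ : G → M → ℝ} (h : IsCoarseCocycle κ σ) (hκ : κ ≤ κ') :
    IsCoarseCocycle κ' σ :=
  ⟨fun g x => (h.1 g x).trans (EReal.coe_le_coe_iff.2 hκ), fun g g' x => (h.2 g g' x).trans hκ⟩

/-- A function on `Γ × ∂X` which is coarsely approximated near the boundary by an additive
cocycle on `Γ × X` is a coarse cocycle. -/
theorem HyperbolicWith.isCoarseCocycle_of_approx (H : HyperbolicWith X δ) {o : X}
    {Γ : Subgroup (X ≃ᵢ X)} {σ : Γ → GromovBoundary X → ℝ} {f : Γ → X → ℝ} {κ : ℝ} {R : Γ → ℝ}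
    (h : ∀ γ x p, Near o (R γ) (bdry x) (of p) → |σ γ x - f γ p| ≤ κ)
    (hf : ∀ (g g' : Γ) (p : X), f (g * g') p = f g (g'.1 p) + f g' p) :
    IsCoarseCocycle (3 * κ) σ := by
  -- Coarse continuity is obtained with `2 * κ`; the sign of `κ` is needed to enlarge this to `3 *
  -- κ`.
  have hκ : 0 ≤ κ ∨ IsEmpty (GromovBoundary X) := by
    by_cases hX : Nonempty (GromovBoundary X)
    · left
      obtain ⟨x⟩ := hX
      have := H.towards_neBot x
      obtain ⟨p, hp⟩ := (H.eventually_near o (R 1) x).exists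
      exact (abs_nonneg _).trans (h 1 x p hp)
    · exact Or.inr (not_nonempty_iff.1 hX)
  constructor
  · intro g x₀
    have hκ' : 0 ≤ κ := hκ.resolve_right fun e => e.elim x₀
    refine limsup_le_of_le (by isBoundedDefault) ?_
    filter_upwards [H.eventually_nhds_near o (R g + δ) x₀] with x hx
    have := H.towards_neBot x
    obtain ⟨p, hp⟩ := (H.eventually_near o (R g + δ) x).exists
    have hδ := H.nonneg
    have h1 := abs_le.1 (h g x p (hp.mono (by linarith)))
    have h2 := abs_le.1 (h g x₀ p ((hx.trans H hp).mono (by linarith)))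
    refine EReal.coe_le_coe_iff.2 ?_
    rw [abs_le]; constructor <;> linarith
  · intro g g' x
    have := H.towards_neBot x
    obtain ⟨p, hp1, hp2, hp3⟩ := ((H.eventually_near o (R (g * g')) x).and
      ((H.eventually_near o (R g') x).and ((H.tendsto_towards g'.1 x).eventually
        (H.eventually_near o (R g) (g'.1 • x))))).exists
    have h1 := abs_le.1 (h _ _ _ hp1)
    have h2 := abs_le.1 (h _ _ _ hp2)
    have h3 := abs_le.1 (h g (g' • x) _ hp3)
    rw [hf] at h1
    rw [abs_le]; constructor <;> linarith

variable {Γ : Subgroup (X ≃ᵢ X)}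

theorem apply_inv_apply_of_subgroup (g : Γ) (p : X) : (g⁻¹ : Γ).1 (g.1 p) = p := by
  change (g⁻¹.1 * g.1) p = p
  rw [← Subgroup.coe_mul, inv_mul_cancel]; rfl

theorem apply_apply_inv_of_subgroup (g : Γ) (p : X) : g.1 ((g⁻¹ : Γ).1 p) = p := by
  change (g.1 * g⁻¹.1) p = p
  rw [← Subgroup.coe_mul, mul_inv_cancel]; rfl

theorem mul_inv_apply_of_subgroup (g h : Γ) (p : X) :
    ((g * h)⁻¹ : Γ).1 p = (h⁻¹ : Γ).1 ((g⁻¹ : Γ).1 p) := by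
  rw [mul_inv_rev]; rfl

namespace IsCoarselyAdditivePotential

theorem exists_isCoarseCocycle (hψ : IsCoarselyAdditivePotential ψ) (H : HyperbolicWith X δ)
    (o : X) (hinv : ∀ γ ∈ Γ, ∀ p q : X, ψ (γ p) (γ q) = ψ p q) :
    ∃ κ, IsCoarseCocycle κ (fun (γ : Γ) x => (potentialCocycle ψ o γ x).toReal) ∧
      IsCoarseCocycle κ (fun (γ : Γ) x => (potentialCocycleBar ψ o γ x).toReal) := by
  obtain ⟨κ, hκ, h⟩ := hψ.exists_cocycle_approx H
  refine ⟨3 * κ, H.isCoarseCocycle_of_approx (f := fun γ p => ψ ((γ⁻¹ : Γ).1 o) p - ψ o p)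
    (fun γ x => (h Γ o γ x).1.2) ?_, H.isCoarseCocycle_of_approx
    (f := fun γ p => ψ p ((γ⁻¹ : Γ).1 o) - ψ p o) (fun γ x => (h Γ o γ x).2.2) ?_⟩
  all_goals
    intro g g' p
    have e1 := hinv _ (g'⁻¹).2 ((g⁻¹ : Γ).1 o) (g'.1 p)
    have e2 := hinv _ (g'⁻¹).2 o (g'.1 p)
    have e3 := hinv _ (g'⁻¹).2 (g'.1 p) ((g⁻¹ : Γ).1 o)
    have e4 := hinv _ (g'⁻¹).2 (g'.1 p) o
    rw [apply_inv_apply_of_subgroup] at e1 e2 e3 e4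
    simp only [mul_inv_apply_of_subgroup]
    linarith

/-- For points of `X` the identity is exact by invariance of `ψ`. The points `p`, `q` are taken so
close to the boundary that their images under `g` are also good approximations; how close depends on
`z` and `g`, but the errors do not. -/
theorem exists_coarse_identity (hψ : IsCoarselyAdditivePotential ψ) (H : HyperbolicWith X δ)
    (o : X) (hinv : ∀ γ ∈ Γ, ∀ p q : X, ψ (γ p) (γ q) = ψ p q) :
    ∃ κ, ∀ (g : Γ) (z : DistinctPairs (GromovBoundary X)),
      |((potentialCocycleBar ψ o g z.1.1).toReal + (potentialCocycle ψ o g z.1.2).toReal) -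
        ((potentialGromovProd ψ o (z.act g)).toReal - (potentialGromovProd ψ o z).toReal)| ≤ κ := by
  obtain ⟨κ, hκ, h⟩ := hψ.exists_cocycle_approx H
  obtain ⟨κ', hκ', h'⟩ := hψ.exists_gromovProd_approx H
  refine ⟨2 * κ + 2 * κ', fun g z => ?_⟩
  obtain ⟨R, hR⟩ := H.exists_not_near o z.2
  obtain ⟨R', hR'⟩ := H.exists_not_near o (z.act g).2
  have := H.towards_neBot z.1.1
  have := H.towards_neBot z.1.2
  obtain ⟨p, hp1, hp2, hp3⟩ := ((H.eventually_near o _ z.1.1).and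
    ((H.eventually_near o _ z.1.1).and ((H.tendsto_towards g.1 z.1.1).eventually
      (H.eventually_near o (R' + 7 * δ + 2) (g.1 • z.1.1))))).exists
  obtain ⟨q, hq1, hq2, hq3⟩ := ((H.eventually_near o _ z.1.2).and
    ((H.eventually_near o _ z.1.2).and ((H.tendsto_towards g.1 z.1.2).eventually
      (H.eventually_near o (R' + 7 * δ + 2) (g.1 • z.1.2))))).exists
  have a1 := abs_le.1 ((h Γ o g z.1.1).2.2 p hp1)
  have a2 := abs_le.1 ((h Γ o g z.1.2).1.2 q hq1)
  have a3 := abs_le.1 ((h' o z R hR).2 (p, q) ⟨hp2, hq2⟩)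
  have a4 := abs_le.1 ((h' o (z.act g) R' hR').2 (g.1 p, g.1 q) ⟨hp3, hq3⟩)
  have e1 := hinv _ g.2 p ((g⁻¹ : Γ).1 o)
  have e2 := hinv _ g.2 ((g⁻¹ : Γ).1 o) q
  have e3 := hinv _ g.2 p q
  rw [apply_apply_inv_of_subgroup] at e1 e2
  simp only [e3, e1, e2] at a3 a4
  rw [abs_le]; constructor <;> linarith

theorem potentialGromovProd_ne (hψ : IsCoarselyAdditivePotential ψ) (H : HyperbolicWith X δ)
    (o : X) (z : DistinctPairs (GromovBoundary X)) :
    potentialGromovProd ψ o z ≠ ⊥ ∧ potentialGromovProd ψ o z ≠ ⊤ := by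
  obtain ⟨κ', hκ', h'⟩ := hψ.exists_gromovProd_approx H
  obtain ⟨R, hR⟩ := H.exists_not_near o z.2
  exact (h' o z R hR).1

theorem exists_le_potentialGromovProd (hψ : IsCoarselyAdditivePotential ψ)
    (H : HyperbolicWith X δ) (o : X) : ∃ c : ℝ, ∀ z : DistinctPairs (GromovBoundary X),
      (c : EReal) ≤ potentialGromovProd ψ o z := by
  obtain ⟨m, hm⟩ := hψ.exists_prod_lower_bound H
  refine ⟨m, fun z => ?_⟩
  have := H.towards_neBot z.1.1
  have := H.towards_neBot z.1.2
  refine le_limsup_of_frequently_le (Eventually.frequently ?_) (by isBoundedDefault)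
  exact Eventually.of_forall fun w => EReal.coe_le_coe_iff.2 (hm o w.1 w.2)

theorem potentialGromovProd_locally_bounded (hψ : IsCoarselyAdditivePotential ψ)
    (H : HyperbolicWith X δ) (o : X) (z : DistinctPairs (GromovBoundary X)) :
    ∃ U ∈ 𝓝 z, ∃ C : ℝ, ∀ q ∈ U, |(potentialGromovProd ψ o q).toReal| ≤ C := by
  obtain ⟨κ, hκ, h⟩ := hψ.exists_gromovProd_approx H
  obtain ⟨R, hR⟩ := H.exists_not_near o z.2
  obtain ⟨κ', hκ', h'⟩ := hψ.exists_additive H (R + 4 * δ)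
  have hδ := H.nonneg
  have n1 : ∀ᶠ w : DistinctPairs (GromovBoundary X) in 𝓝 z,
      Near o (R + 2 * δ) (bdry z.1.1) (bdry w.1.1) :=
    (continuous_fst.comp continuous_subtype_val).continuousAt.eventually
      (H.eventually_nhds_near o (R + 2 * δ) z.1.1)
  have n2 : ∀ᶠ w : DistinctPairs (GromovBoundary X) in 𝓝 z,
      Near o (R + 2 * δ) (bdry z.1.2) (bdry w.1.2) :=
    (continuous_snd.comp continuous_subtype_val).continuousAt.eventually
      (H.eventually_nhds_near o (R + 2 * δ) z.1.2)
  refine ⟨_, n1.and n2, κ + κ', fun w hw => ?_⟩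
  have hw' : ¬ Near o (R + 2 * δ) (bdry w.1.1) (bdry w.1.2) := fun hn =>
    hR (((hw.1.trans H hn).trans H (hw.2.symm.mono (by linarith))).mono (by linarith))
  have := H.towards_neBot w.1.1
  have := H.towards_neBot w.1.2
  obtain ⟨p, hp⟩ := (H.eventually_near o (R + 2 * δ + 7 * δ + 2) w.1.1).exists
  obtain ⟨q, hq⟩ := (H.eventually_near o (R + 2 * δ + 7 * δ + 2) w.1.2).exists
  have a1 := abs_le.1 ((h o w _ hw').2 (p, q) ⟨hp, hq⟩)
  -- Points approximating a pair near `z` have bounded Gromov product, so additivity applies at `o`.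
  have a2 := abs_le.1 (h' p q o (by
    by_contra! hpq
    refine hw' ?_
    have h1 : Near o (R + 4 * δ) (of p) (of q) := near_of_iff.2 hpq.le
    have h2 := (hp.mono (by linarith : R + 4 * δ ≤ _)).trans H h1
    exact (h2.trans H (hq.symm.mono (by linarith))).mono (by linarith)))
  simp only at a1
  rw [abs_le]; constructor <;> linarith

/-- Away from `γ⁻¹ o`, both cocycles agree with the potential up to a bounded error. -/
theorem exists_magnitude_bound (hψ : IsCoarselyAdditivePotential ψ) (H : HyperbolicWith X δ)
    (o : X) (R : ℝ) : ∃ C > 0, ∀ (γ : Γ) (x : GromovBoundary X),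
      ¬ Near o R (bdry x) (of ((γ⁻¹ : Γ).1 o)) →
      |(potentialCocycle ψ o γ x).toReal - ψ ((γ⁻¹ : Γ).1 o) o| ≤ C ∧
      |(potentialCocycleBar ψ o γ x).toReal - ψ o ((γ⁻¹ : Γ).1 o)| ≤ C := by
  obtain ⟨κ, hκ, h⟩ := hψ.exists_cocycle_approx H
  obtain ⟨κ', hκ', h'⟩ := hψ.exists_additive H (R + δ)
  refine ⟨κ + κ', by positivity, fun γ x hx => ?_⟩
  have := H.towards_neBot x
  obtain ⟨p, hp, hp'⟩ := ((H.eventually_near o _ x).and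
    (H.eventually_near o (R + δ) x)).exists
  have a1 := abs_le.1 ((h Γ o γ x).1.2 p hp)
  have a2 := abs_le.1 ((h Γ o γ x).2.2 p hp)
  -- Thus `o` is close to a geodesic between `γ⁻¹ o` and `p`, and `ψ` splits at `o` in both
  -- directions.
  have hfar : gromovProd o p ((γ⁻¹ : Γ).1 o) ≤ R + δ := by
    by_contra! hpq
    exact hx ((hp'.trans H (near_of_iff.2 hpq.le)).mono (by linarith))
  have b1 := abs_le.1 (h' p _ o hfar)
  rw [gromovProd_comm] at hfar
  have b2 := abs_le.1 (h' _ p o hfar)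
  constructor <;> rw [abs_le] <;> constructor <;> linarith

end IsCoarselyAdditivePotential

end Potential

/-! ## Discrete groups of isometries and limits of points -/

section ProperSpace

variable {X : Type u} [MetricSpace X] {δ : ℝ} {Γ : Subgroup (X ≃ᵢ X)}

theorem IsDiscreteIsometryGroup.exists_compact (hdisc : IsDiscreteIsometryGroup Γ) :
    ∃ (K : Set X) (ε : ℝ), IsCompact K ∧ 0 < ε ∧
      ∀ γ : Γ, (∀ x ∈ K, dist (γ.1 x) x < ε) → γ = 1 := by
  set F : Γ → C(X, X) := fun γ => ⟨(γ : X ≃ᵢ X), (γ : X ≃ᵢ X).continuous⟩ with hF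
  have h1 : @IsOpen Γ (TopologicalSpace.induced F inferInstance) {1} :=
    @isOpen_discrete Γ (TopologicalSpace.induced F inferInstance) hdisc {1}
  obtain ⟨t, ht, ht1⟩ := isOpen_induced_iff.1 h1
  have h2 : t ∈ 𝓝 (F 1) := ht.mem_nhds (show (1 : Γ) ∈ F ⁻¹' t by rw [ht1]; rfl)
  obtain ⟨⟨K, ε⟩, ⟨hK, hε⟩, h3⟩ := (nhds_basis_uniformity'
    (Metric.uniformity_basis_dist.compactConvergenceUniformity)).mem_iff.1 h2
  refine ⟨K, ε, hK, hε, fun γ hγ => ?_⟩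
  have : γ ∈ F ⁻¹' t := h3 (fun x hx => by
    have := hγ x hx
    rw [dist_comm] at this
    exact this)
  rwa [ht1] at this

/-- Pigeonhole: on a finite `ε / 3`-net of `K`, the images under such elements lie in a compact
product of balls. Infinitely many elements would include distinct `γ`, `γ'` agreeing on the net up
to `ε / 3`, so `γ⁻¹ γ'` would move points of `K` by less than `ε`. -/
theorem IsDiscreteIsometryGroup.finite [ProperSpace X] (hdisc : IsDiscreteIsometryGroup Γ)
    (o : X) (R : ℝ) : {γ : Γ | dist o (γ.1 o) ≤ R}.Finite := by
  obtain ⟨K, ε, hK, hε, h⟩ := hdisc.exists_compact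
  obtain ⟨t, htK, htf, ht⟩ := hK.finite_cover_balls
    (by positivity : (0 : ℝ) < ε / 3)
  have := htf.fintype
  by_contra hinf
  have hinf : {γ : Γ | dist o (γ.1 o) ≤ R}.Infinite := hinf
  obtain ⟨s, -, hsf, hs⟩ := (isCompact_univ_pi
    fun x : t => isCompact_closedBall o (R + dist o x.1)).finite_cover_balls (by positivity : (0 : ℝ) < ε / 6)
  have hmem : ∀ γ : Γ, dist o (γ.1 o) ≤ R → ∃ y ∈ s,
      dist (fun x : t => γ.1 x.1) y < ε / 6 := by
    intro γ hγ
    have := hs (show (fun x : t => γ.1 x.1) ∈ univ.pi _ from fun x _ => by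
      rw [Metric.mem_closedBall, dist_comm]
      refine (dist_triangle _ (γ.1 o) _).trans ?_
      rw [γ.1.isometry.dist_eq]
      gcongr)
    simpa using this
  have : Nonempty X := ⟨o⟩
  choose! y hy hyd using hmem
  obtain ⟨γ, hγ, γ', hγ', hne, heq⟩ := hinf.exists_ne_map_eq_of_mapsTo (f := y)
    (fun γ hγ => hy γ hγ) hsf
  have hclose : dist (fun x : t => γ.1 x.1) (fun x : t => γ'.1 x.1) < ε / 3 := by
    have a := hyd γ hγ
    have b := hyd γ' hγ'
    rw [← heq] at b
    have := dist_triangle_right (fun x : t => γ.1 x.1) (fun x : t => γ'.1 x.1) (y γ)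
    linarith
  refine hne (inv_mul_eq_one.1 (h (γ⁻¹ * γ') fun x hx => ?_))
  obtain ⟨z, hz, hxz⟩ := mem_iUnion₂.1 (ht hx)
  rw [Metric.mem_ball] at hxz
  have e : dist ((γ⁻¹ * γ' : Γ).1 x) x = dist (γ'.1 x) (γ.1 x) := by
    rw [← γ.1.isometry.dist_eq]
    congr 1
    exact apply_apply_inv_of_subgroup γ (γ'.1 x)
  have h1 : dist (γ.1 z) (γ'.1 z) < ε / 3 :=
    lt_of_le_of_lt (dist_le_pi_dist (fun x : t => γ.1 x.1) (fun x : t => γ'.1 x.1) ⟨z, hz⟩) hclose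
  have h2 := dist_triangle4 (γ'.1 x) (γ'.1 z) (γ.1 z) (γ.1 x)
  rw [γ'.1.isometry.dist_eq, γ.1.isometry.dist_eq, dist_comm (γ'.1 z), dist_comm z x] at h2
  rw [e]
  linarith

open GromovBordification

/-- A sequence of points tending to infinity accumulates at some boundary point: a limit of
geodesics from `o` to these points is a geodesic ray. -/
theorem HyperbolicWith.exists_cluster [ProperSpace X] (H : HyperbolicWith X δ)
    (hgeod : IsGeodesicSpace X) (o : X) {p : ℕ → X}
    (hp : Tendsto (fun n => dist o (p n)) atTop atTop) :
    ∃ ξ : GromovBoundary X, ∀ R, ∃ᶠ n in atTop, Near o R (bdry ξ) (of (p n)) := by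
  -- Limits along one ultrafilter exist for all times simultaneously, which replaces a diagonal
  -- extraction.
  have hU : (hyperfilter ℕ : Filter ℕ) ≤ atTop := Nat.hyperfilter_le_atTop
  choose c hc using fun n => hgeod o (p n)
  have hlong : ∀ t : ℝ≥0, ∀ᶠ n in (hyperfilter ℕ : Filter ℕ),
      (t : ℝ) ∈ Icc (0 : ℝ) (dist o (p n)) := fun t =>
    hU ((hp.eventually_ge_atTop t).mono fun n hn => ⟨t.2, hn⟩)
  have hlim : ∀ t : ℝ≥0, ∃ x, Tendsto (fun n => c n t) (hyperfilter ℕ) (𝓝 x) := by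
    intro t
    obtain ⟨x, -, hx⟩ := (isCompact_closedBall o (t : ℝ)).ultrafilter_le_nhds
      ((hyperfilter ℕ).map fun n => c n t) (by
        rw [le_principal_iff]
        refine (hlong t).mono fun n hn => ?_
        show c n t ∈ Metric.closedBall o t
        rw [Metric.mem_closedBall, dist_comm, (hc n).dist_left hn])
    exact ⟨x, hx⟩
  choose r hr using hlim
  have hiso : Isometry r := by
    refine Isometry.of_dist_eq fun s t => ?_
    refine tendsto_nhds_unique ((hr s).dist (hr t)) (tendsto_const_nhds.congr' ?_)
    filter_upwards [hlong s, hlong t] with n hs ht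
    rw [(hc n).2.2 s hs t ht, NNReal.dist_eq]
  refine ⟨GeodesicRay.endpoint ⟨r, hiso⟩, fun R => ?_⟩
  obtain ⟨t₀, ht₀⟩ := H.near_endpoint ⟨r, hiso⟩ o (R + δ + 1)
  set t := max t₀ (Real.toNNReal (R + δ)) with ht
  have htR : R + δ ≤ t := Real.toNNReal_le_iff_le_coe.1 (le_max_right _ _)
  refine Frequently.filter_mono (Eventually.frequently ?_) hU
  filter_upwards [hlong t, (hr t).eventually (Metric.ball_mem_nhds _ one_pos)] with n hn hd
  rw [dist_comm] at hd
  have h1 := (ht₀ t (le_max_left _ _)).of_dist (p' := c n t)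
  have h2 : gromovProd o (c n t) (p n) = t := by
    have a := (hc n).dist_left hn
    have b := (hc n).between hn
    unfold gromovProd
    linarith
  have h3 : Near o (R + δ) (of (c n t)) (of (p n)) := near_of_iff.2 (by rw [h2]; exact htR)
  refine ((h1.mono (?_ : R + δ ≤ _)).trans H h3).mono (by linarith)
  have : dist (r t) (c n t) < 1 := hd
  show R + δ ≤ R + δ + 1 - dist (r t) (c n t)
  linarith

end ProperSpace

/-! ## The compactification `Γ ⊔ ∂X` -/

section GroupUnion

variable {X : Type u} [MetricSpace X] {δ : ℝ} {Γ : Subgroup (X ≃ᵢ X)}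

open GromovBordification

/-- The orbit map `Γ ⊔ ∂X → X ⊔ ∂X`. -/
def orbitMap (o : X) : GroupUnion Γ (GromovBoundary X) → GromovBordification X
  | .elt g => of (g.1 o)
  | .pt ξ => bdry ξ

theorem orbitMap_smul (o : X) (g : Γ) (z : GroupUnion Γ (GromovBoundary X)) :
    orbitMap o (g • z) = map g.1 (orbitMap o z) := by
  rcases z with h | ξ <;> rfl

/-- The entourages of `Γ ⊔ ∂X`. -/
def orbitEntourage (Γ : Subgroup (X ≃ᵢ X)) (o : X) (n : ℕ) :
    Set (GroupUnion Γ (GromovBoundary X) × GroupUnion Γ (GromovBoundary X)) :=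
  {z | z.1 = z.2 ∨ Near o n (orbitMap o z.1) (orbitMap o z.2)}

theorem orbitEntourage_hasBasis (Γ : Subgroup (X ≃ᵢ X)) (o : X) :
    (⨅ n, 𝓟 (orbitEntourage Γ o n)).HasBasis (fun _ => True) (orbitEntourage Γ o) := by
  refine hasBasis_iInf_principal (Antitone.directed_ge fun m n hmn z hz => ?_)
  exact hz.imp id fun h => h.mono (by exact_mod_cast hmn)

/-- The uniform structure of `Γ ⊔ ∂X`. -/
@[reducible]
def HyperbolicWith.orbitUniformSpace (H : HyperbolicWith X δ) (Γ : Subgroup (X ≃ᵢ X)) (o : X) :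
    UniformSpace (GroupUnion Γ (GromovBoundary X)) :=
  UniformSpace.ofCore <| UniformSpace.Core.mk' (⨅ n, 𝓟 (orbitEntourage Γ o n))
    (fun r hr x => by
      obtain ⟨n, -, hn⟩ := (orbitEntourage_hasBasis Γ o).mem_iff.1 hr
      exact hn (Or.inl rfl))
    (fun r hr => by
      obtain ⟨n, -, hn⟩ := (orbitEntourage_hasBasis Γ o).mem_iff.1 hr
      exact (orbitEntourage_hasBasis Γ o).mem_iff.2
        ⟨n, trivial, fun z hz => hn (hz.imp Eq.symm Near.symm)⟩)
    (fun r hr => by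
      obtain ⟨n, -, hn⟩ := (orbitEntourage_hasBasis Γ o).mem_iff.1 hr
      -- The excess `δ` absorbs the loss in `Near.trans`.
      obtain ⟨m, hm⟩ := exists_nat_ge (n + δ)
      refine ⟨_, (orbitEntourage_hasBasis Γ o).mem_of_mem (i := m) trivial, ?_⟩
      rintro ⟨x, z⟩ ⟨y, hxy, hyz⟩
      refine hn ?_
      have hδ := H.nonneg
      rcases hxy with hxy | hxy
      · obtain rfl : x = y := hxy
        exact hyz.imp id fun h => h.mono (by linarith)
      · rcases hyz with hyz | hyz
        · obtain rfl : y = z := hyz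
          exact Or.inr (hxy.mono (by linarith))
        · exact Or.inr ((Near.trans H hxy hyz).mono (by linarith)))

theorem HyperbolicWith.orbit_nhds_basis (H : HyperbolicWith X δ) (o : X)
    (z : GroupUnion Γ (GromovBoundary X)) :
    letI := H.orbitUniformSpace Γ o
    (𝓝 z).HasBasis (fun _ => True) (fun n : ℕ =>
      {w | z = w ∨ Near o n (orbitMap o z) (orbitMap o w)}) :=
  let := H.orbitUniformSpace Γ o
  have h : (uniformity (GroupUnion Γ (GromovBoundary X))).HasBasis (fun _ : ℕ => True)
      (orbitEntourage Γ o) := orbitEntourage_hasBasis Γ o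
  nhds_basis_uniformity' h

theorem HyperbolicWith.mem_orbit_nhds_iff (H : HyperbolicWith X δ) (o : X)
    {z : GroupUnion Γ (GromovBoundary X)} {S : Set (GroupUnion Γ (GromovBoundary X))} :
    letI := H.orbitUniformSpace Γ o
    S ∈ 𝓝 z ↔ ∃ R : ℝ, ∀ w, z = w ∨ Near o R (orbitMap o z) (orbitMap o w) → w ∈ S := by
  let := H.orbitUniformSpace Γ o
  rw [(H.orbit_nhds_basis o z).mem_iff]
  constructor
  · rintro ⟨n, -, hn⟩
    exact ⟨n, fun w hw => hn hw⟩
  · rintro ⟨R, hR⟩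
    obtain ⟨n, hn⟩ := exists_nat_ge R
    exact ⟨n, trivial, fun w hw => hR w (hw.imp id fun h => h.mono hn)⟩

theorem HyperbolicWith.eq_of_forall_orbit_near (H : HyperbolicWith X δ) {o : X}
    {z : GroupUnion Γ (GromovBoundary X)} {ξ : GromovBoundary X}
    (h : ∀ R, Near o R (bdry ξ) (orbitMap o z)) : z = .pt ξ := by
  rcases z with g | η
  · have := (h (dist o (g.1 o) + 1)).le_dist
    linarith
  · rw [H.eq_of_forall_near h]

theorem HyperbolicWith.orbit_countable (H : HyperbolicWith X δ) (Γ : Subgroup (X ≃ᵢ X)) (o : X) :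
    letI := H.orbitUniformSpace Γ o
    IsCountablyGenerated (uniformity (GroupUnion Γ (GromovBoundary X))) :=
  (orbitEntourage_hasBasis Γ o).isCountablyGenerated

/-- Gromov products with `g o` never exceed `d(o, g o)`, so a fine enough entourage relates `g` only
to itself. -/
theorem HyperbolicWith.orbit_singleton_mem_nhds (H : HyperbolicWith X δ) (o : X) (g : Γ) :
    letI := H.orbitUniformSpace Γ o
    {GroupUnion.elt g} ∈ 𝓝 (GroupUnion.elt g : GroupUnion Γ (GromovBoundary X)) := by
  refine (H.mem_orbit_nhds_iff o).2 ⟨dist o (g.1 o) + 1, ?_⟩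
  rintro w (rfl | hw)
  · rfl
  · have : _ ≤ dist o (g.1 o) := hw.symm.le_dist
    linarith

theorem HyperbolicWith.orbit_t0Space (H : HyperbolicWith X δ) (Γ : Subgroup (X ≃ᵢ X)) (o : X) :
    letI := H.orbitUniformSpace Γ o
    T0Space (GroupUnion Γ (GromovBoundary X)) := by
  let := H.orbitUniformSpace Γ o
  refine ⟨fun z w h => ?_⟩
  rcases z with g | ξ
  · have := H.orbit_singleton_mem_nhds o g
    rw [h.nhds_eq] at this
    have h2 : w ∈ {GroupUnion.elt g} := mem_of_mem_nhds this
    exact h2.symm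
  · by_contra hne
    refine hne (H.eq_of_forall_orbit_near (o := o) fun R => ?_).symm
    have : {w | GroupUnion.pt ξ = w ∨ Near o R (bdry ξ) (orbitMap o w)} ∈
        𝓝 (GroupUnion.pt ξ : GroupUnion Γ (GromovBoundary X)) :=
      (H.mem_orbit_nhds_iff o).2 ⟨R, fun _ => id⟩
    rw [h.nhds_eq] at this
    exact (mem_of_mem_nhds this).resolve_left hne

theorem HyperbolicWith.orbit_isEmbedding_pt (H : HyperbolicWith X δ) (Γ : Subgroup (X ≃ᵢ X))
    (o : X) :
    letI := H.orbitUniformSpace Γ o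
    IsEmbedding (GroupUnion.pt : GromovBoundary X → GroupUnion Γ (GromovBoundary X)) := by
  let := H.orbitUniformSpace Γ o
  refine ⟨isInducing_iff_nhds.2 fun ξ => ?_, fun ξ η h => GroupUnion.pt.inj h⟩
  ext S
  rw [H.mem_nhds_boundary_iff o, mem_comap]
  constructor
  · rintro ⟨R, hR⟩
    refine ⟨_, (H.mem_orbit_nhds_iff o).2 ⟨R, fun _ => id⟩, ?_⟩
    rintro η (h | h)
    · cases h
      exact hR _ (near_self o R _)
    · exact hR _ h
  · rintro ⟨t, ht, hS⟩
    obtain ⟨R, hR⟩ := (H.mem_orbit_nhds_iff o).1 ht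
    exact ⟨R, fun η hη => hS (hR _ (Or.inr hη))⟩

theorem HyperbolicWith.orbit_isEmbedding_elt (H : HyperbolicWith X δ) (Γ : Subgroup (X ≃ᵢ X))
    (o : X) :
    letI := H.orbitUniformSpace Γ o
    @IsEmbedding Γ (GroupUnion Γ (GromovBoundary X)) ⊥ _ GroupUnion.elt := by
  let := H.orbitUniformSpace Γ o
  let : TopologicalSpace Γ := ⊥
  have : DiscreteTopology Γ := ⟨rfl⟩
  refine ⟨isInducing_iff_nhds.2 fun g => ?_, fun g h e => GroupUnion.elt.inj e⟩
  rw [nhds_discrete]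
  refine le_antisymm ?_ ?_
  · exact map_le_iff_le_comap.1 (by rw [map_pure]; exact pure_le_nhds _)
  · rw [le_pure_iff]
    exact ⟨_, H.orbit_singleton_mem_nhds o g, fun h e => GroupUnion.elt.inj e⟩

theorem HyperbolicWith.orbit_continuous_smul (H : HyperbolicWith X δ) (o : X) (g : Γ) :
    letI := H.orbitUniformSpace Γ o
    Continuous fun z : GroupUnion Γ (GromovBoundary X) => g • z := by
  let := H.orbitUniformSpace Γ o
  refine continuous_iff_continuousAt.2 fun z S hS => ?_
  obtain ⟨R, hR⟩ := (H.mem_orbit_nhds_iff o).1 hS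
  refine (H.mem_orbit_nhds_iff o).2 ⟨R + dist o (g.1 o), ?_⟩
  rintro w (rfl | hw)
  · exact hR _ (Or.inl rfl)
  · refine hR _ (Or.inr ?_)
    rw [orbitMap_smul, orbitMap_smul]
    exact (hw.map_base g.1).mono (by linarith)

/-! ### Compactness of `Γ ⊔ ∂X` and the convergence property. -/

theorem IsDiscreteIsometryGroup.tendsto_cofinite [ProperSpace X]
    (hdisc : IsDiscreteIsometryGroup Γ) (o : X) :
    Tendsto (fun g : Γ => dist o (g.1 o)) cofinite atTop := by
  refine tendsto_atTop.2 fun R => ?_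
  rw [eventually_cofinite]
  refine (hdisc.finite o R).subset fun g hg => ?_
  exact (not_le.1 hg).le

theorem dist_inv_apply (o : X) (g : Γ) : dist o ((g⁻¹ : Γ).1 o) = dist o (g.1 o) := by
  rw [← g.1.isometry.dist_eq, apply_apply_inv_of_subgroup, dist_comm]

theorem HyperbolicWith.orbit_compactSpace [ProperSpace X] (H : HyperbolicWith X δ)
    (hgeod : IsGeodesicSpace X) (hdisc : IsDiscreteIsometryGroup Γ) (o : X) :
    letI := H.orbitUniformSpace Γ o
    CompactSpace (GroupUnion Γ (GromovBoundary X)) := by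
  let := H.orbitUniformSpace Γ o
  have := H.orbit_countable Γ o
  have := H.orbit_t0Space Γ o
  have : TopologicalSpace.MetrizableSpace (GroupUnion Γ (GromovBoundary X)) :=
    UniformSpace.metrizableSpace
  refine ⟨isCompact_iff_isSeqCompact.2 fun z _ => ?_⟩
  suffices h : ∃ a, MapClusterPt a atTop z by
    obtain ⟨a, ha⟩ := h
    exact ⟨a, mem_univ a, ha.tendsto_subseq⟩
  by_cases hcase : ∃ g : Γ, ∃ᶠ k in atTop, z k = .elt g
  · obtain ⟨g, hg⟩ := hcase
    refine ⟨.elt g, mapClusterPt_iff_frequently.2 fun S hS => hg.mono fun k hk => ?_⟩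
    rw [hk]
    exact mem_of_mem_nhds hS
  · push Not at hcase
    -- Boundary terms are replaced by ever closer points of `X`. When no group element recurs
    -- infinitely often, discreteness sends these points to infinity and `exists_cluster` applies.
    have happrox : ∀ k : ℕ, ∃ p : X, orbitMap o (z k) = of p ∨
        Near o k (orbitMap o (z k)) (of p) := by
      intro k
      rcases z k with g | ξ
      · exact ⟨_, Or.inl rfl⟩
      · obtain ⟨r, rfl⟩ := Quotient.exists_rep ξ
        obtain ⟨t, ht⟩ := H.near_endpoint r o k
        exact ⟨_, Or.inr (ht t le_rfl)⟩
    choose p hp using happrox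
    have hinf : Tendsto (fun k => dist o (p k)) atTop atTop := by
      refine tendsto_atTop.2 fun R => ?_
      have h1 : ∀ᶠ k in atTop, ∀ g ∈ {γ : Γ | dist o (γ.1 o) ≤ R}, z k ≠ .elt g :=
        (eventually_all_finite (hdisc.finite o R)).2 fun g _ => hcase g
      filter_upwards [h1, eventually_ge_atTop ⌈R⌉₊] with k hk hkR
      have hkR' : R ≤ k := (Nat.le_ceil R).trans (by exact_mod_cast hkR)
      rcases hp k with h | h
      · rcases hz : z k with g | ξ
        · rw [hz] at h
          have h : g.1 o = p k := by simpa [orbitMap] using h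
          by_contra! hlt
          exact hk g (by rw [← h] at hlt; exact hlt.le) hz
        · rw [hz] at h
          cases h
      · exact hkR'.trans h.le_dist
    obtain ⟨ξ, hξ⟩ := H.exists_cluster hgeod o hinf
    refine ⟨.pt ξ, mapClusterPt_iff_frequently.2 fun S hS => ?_⟩
    obtain ⟨R, hR⟩ := (H.mem_orbit_nhds_iff o).1 hS
    have hδ := H.nonneg
    refine ((hξ (R + δ)).and_eventually (eventually_ge_atTop ⌈R + δ⌉₊)).mono
      fun k ⟨hk, hkR⟩ => hR _ (Or.inr ?_)
    have hkR' : R + δ ≤ k := (Nat.le_ceil _).trans (by exact_mod_cast hkR)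
    rcases hp k with h | h
    · rw [h]
      exact hk.mono (by linarith)
    · exact (hk.trans H (h.symm.mono hkR')).mono (by linarith)

/-- `γₙ o → a` and `γₙ⁻¹ o → b` in `X ⊔ ∂X`. -/
structure OrbitTendsto (o : X) (γ : ℕ → Γ) (b a : GromovBoundary X) : Prop where
  attracting : ∀ R, ∀ᶠ n in atTop, Near o R (bdry a) (of ((γ n).1 o))
  repelling : ∀ R, ∀ᶠ n in atTop, Near o R (bdry b) (of (((γ n)⁻¹ : Γ).1 o))

theorem HyperbolicWith.exists_subseq_near [ProperSpace X] (H : HyperbolicWith X δ)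
    (hgeod : IsGeodesicSpace X) (o : X) {p : ℕ → X}
    (hp : Tendsto (fun n => dist o (p n)) atTop atTop) :
    ∃ (ξ : GromovBoundary X) (φ : ℕ → ℕ), StrictMono φ ∧
      ∀ R, ∀ᶠ n in atTop, Near o R (bdry ξ) (of (p (φ n))) := by
  obtain ⟨ξ, hξ⟩ := H.exists_cluster hgeod o hp
  obtain ⟨φ, hφ, h⟩ := extraction_forall_of_frequently fun n : ℕ => hξ n
  refine ⟨ξ, φ, hφ, fun R => ?_⟩
  filter_upwards [eventually_ge_atTop ⌈R⌉₊] with n hn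
  exact (h n).mono ((Nat.le_ceil R).trans (by exact_mod_cast hn))

theorem HyperbolicWith.exists_orbitTendsto [ProperSpace X] (H : HyperbolicWith X δ)
    (hgeod : IsGeodesicSpace X) (hdisc : IsDiscreteIsometryGroup Γ) (o : X) {γ : ℕ → Γ}
    (hγ : Function.Injective γ) : ∃ (a b : GromovBoundary X) (φ : ℕ → ℕ), StrictMono φ ∧
      OrbitTendsto o (γ ∘ φ) b a := by
  have h1 : Tendsto (fun n => dist o ((γ n).1 o)) atTop atTop := by
    have := (hdisc.tendsto_cofinite o).comp hγ.tendsto_cofinite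
    rwa [Nat.cofinite_eq_atTop] at this
  obtain ⟨a, φ, hφ, ha⟩ := H.exists_subseq_near hgeod o h1
  have h2 : Tendsto (fun n => dist o (((γ (φ n))⁻¹ : Γ).1 o)) atTop atTop := by
    simp only [dist_inv_apply]
    exact h1.comp hφ.tendsto_atTop
  obtain ⟨b, φ', hφ', hb⟩ := H.exists_subseq_near hgeod o h2
  exact ⟨a, b, φ ∘ φ', hφ.comp hφ', fun R => hφ'.tendsto_atTop.eventually (ha R), hb⟩

theorem OrbitTendsto.comp {o : X} {γ : ℕ → Γ} {a b : GromovBoundary X}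
    (h : OrbitTendsto o γ b a) {φ : ℕ → ℕ} (hφ : StrictMono φ) : OrbitTendsto o (γ ∘ φ) b a :=
  ⟨fun R => hφ.tendsto_atTop.eventually (h.1 R), fun R => hφ.tendsto_atTop.eventually (h.2 R)⟩

/-- Away from `b` means away from `γₙ⁻¹ o`, so `near_map_of_not_near` puts the image near `γₙ o`,
hence near `a`. The index is uniform in `w`, as local uniform convergence requires. -/
theorem OrbitTendsto.eventually_near (H : HyperbolicWith X δ) {o : X} {γ : ℕ → Γ}
    {a b : GromovBoundary X} (h : OrbitTendsto o γ b a) (R S : ℝ) :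
    ∀ᶠ n in atTop, ∀ w, ¬ Near o S (bdry b) w → Near o R (bdry a) (map (γ n).1 w) := by
  have hδ := H.nonneg
  filter_upwards [h.attracting (R + δ), h.attracting (R + S + 4 * δ),
    h.repelling (S + δ)] with n h1 h2 h3 w hw
  have h4 : ¬ Near o (S + δ) w (of ((γ n).1⁻¹ o)) := fun h4 =>
    hw ((h3.trans H h4.symm).mono (by linarith))
  have h5 := H.near_map_of_not_near (γ n).1 h4
  have h6 := h2.le_dist
  exact (h1.trans H (h5.symm.mono (by linarith))).mono (by linarith)

theorem OrbitTendsto.collapsesTo_union (H : HyperbolicWith X δ) {o : X} {γ : ℕ → Γ}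
    {a b : GromovBoundary X} (h : OrbitTendsto o γ b a) :
    letI := H.orbitUniformSpace Γ o
    CollapsesTo (M := GroupUnion Γ (GromovBoundary X)) γ (.pt b) (.pt a) := by
  let := H.orbitUniformSpace Γ o
  intro z hz U hU
  obtain ⟨R, hR⟩ := (H.mem_orbit_nhds_iff o).1 hU
  obtain ⟨S, hS⟩ : ∃ S, ¬ Near o S (bdry b) (orbitMap o z) := by
    by_contra! h'
    exact hz (H.eq_of_forall_orbit_near h')
  have hδ := H.nonneg
  refine ⟨_, (H.mem_orbit_nhds_iff o).2 ⟨S + δ, fun _ => id⟩, ?_⟩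
  filter_upwards [h.eventually_near H R (S + δ)] with n hn w hw _
  refine hR _ (Or.inr ?_)
  rw [orbitMap_smul]
  refine hn _ fun hbw => ?_
  rcases hw with rfl | hw
  · exact hS (hbw.mono (by linarith))
  · exact hS ((hbw.trans H hw.symm).mono (by linarith))

theorem HyperbolicWith.orbit_isConvergenceGroup [ProperSpace X] (H : HyperbolicWith X δ)
    (hgeod : IsGeodesicSpace X) (hdisc : IsDiscreteIsometryGroup Γ) (o : X) :
    letI := H.orbitUniformSpace Γ o
    IsConvergenceGroup Γ (GroupUnion Γ (GromovBoundary X)) := by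
  let := H.orbitUniformSpace Γ o
  have := H.orbit_countable Γ o
  have := H.orbit_t0Space Γ o
  refine ⟨H.orbit_compactSpace hgeod hdisc o, UniformSpace.metrizableSpace,
    H.orbit_continuous_smul o, fun γ hγ => ?_⟩
  obtain ⟨a, b, φ, hφ, h⟩ := H.exists_orbitTendsto hgeod hdisc o hγ
  exact ⟨.pt a, .pt b, φ, hφ, h.collapsesTo_union H⟩

theorem HyperbolicWith.exists_isCompatibleMetric [ProperSpace X] (H : HyperbolicWith X δ)
    (hgeod : IsGeodesicSpace X) (hdisc : IsDiscreteIsometryGroup Γ) (o : X) :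
    ∃ d : MetricSpace (GroupUnion Γ (GromovBoundary X)), IsCompatibleMetric d := by
  let := H.orbitUniformSpace Γ o
  have := H.orbit_countable Γ o
  have := H.orbit_t0Space Γ o
  exact ⟨UniformSpace.metricSpace _, H.orbit_compactSpace hgeod hdisc o,
    H.orbit_isEmbedding_elt Γ o, H.orbit_isEmbedding_pt Γ o,
    H.orbit_isConvergenceGroup hgeod hdisc o⟩

theorem CollapsesTo.of_union {G : Type u} {M : Type v} [Group G] [MulAction G M]
    [TopologicalSpace M] [TopologicalSpace (GroupUnion G M)]
    (hpt : IsEmbedding (GroupUnion.pt : M → GroupUnion G M)) {γ : ℕ → G} {a b : M}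
    (h : CollapsesTo (M := GroupUnion G M) γ (.pt b) (.pt a)) : CollapsesTo γ b a := by
  intro z hz U hU
  rw [hpt.isInducing.nhds_eq_comap] at hU
  obtain ⟨U', hU', hUU⟩ := hU
  obtain ⟨V, hV, hVe⟩ := h (.pt z) (fun e => hz (GroupUnion.pt.inj e)) U' hU'
  refine ⟨_, hpt.continuous.continuousAt hV, hVe.mono fun n hn w hw hwb => hUU ?_⟩
  exact hn _ hw fun e => hwb (GroupUnion.pt.inj e)

theorem OrbitTendsto.collapsesTo (H : HyperbolicWith X δ) {o : X} {γ : ℕ → Γ}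
    {a b : GromovBoundary X} (h : OrbitTendsto o γ b a) : CollapsesTo γ b a :=
  let := H.orbitUniformSpace Γ o
  CollapsesTo.of_union (H.orbit_isEmbedding_pt Γ o) (h.collapsesTo_union H)

theorem HyperbolicWith.boundary_isConvergenceGroup [ProperSpace X] (H : HyperbolicWith X δ)
    (hgeod : IsGeodesicSpace X) (hdisc : IsDiscreteIsometryGroup Γ) (o : X) :
    IsConvergenceGroup Γ (GromovBoundary X) := by
  let := H.orbitUniformSpace Γ o
  have hpt := H.orbit_isEmbedding_pt Γ o
  have hconv := H.orbit_isConvergenceGroup hgeod hdisc o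
  have := hconv.compact
  have := hconv.metrizable
  -- Group elements are isolated, so the boundary is closed and inherits compactness.
  have hclosed : IsClosed (range (GroupUnion.pt : GromovBoundary X →
      GroupUnion Γ (GromovBoundary X))) := by
    rw [← isOpen_compl_iff, isOpen_iff_mem_nhds]
    rintro (g | ξ) hz
    · refine mem_of_superset (H.orbit_singleton_mem_nhds o g) ?_
      rintro _ rfl ⟨ξ, h⟩
      cases h
    · exact absurd ⟨ξ, rfl⟩ hz
  refine ⟨(IsClosedEmbedding.mk hpt hclosed).compactSpace, hpt.metrizableSpace, fun g => ?_,
    fun γ hγ => ?_⟩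
  · rw [hpt.isInducing.continuous_iff]
    exact (hconv.continuous g).comp hpt.continuous
  · obtain ⟨a, b, φ, hφ, h⟩ := H.exists_orbitTendsto hgeod hdisc o hγ
    exact ⟨a, b, φ, hφ, h.collapsesTo H⟩

end GroupUnion

/-! ## Collapsing sequences and loxodromic elements -/

section Collapse

variable {G : Type u} {M : Type v} [Group G] [MulAction G M] [TopologicalSpace M]

theorem CollapsesTo.comp {γ : ℕ → G} {a b : M} (h : CollapsesTo γ b a) {φ : ℕ → ℕ}
    (hφ : Tendsto φ atTop atTop) : CollapsesTo (γ ∘ φ) b a := by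
  intro z hz U hU
  obtain ⟨V, hV, he⟩ := h z hz U hU
  exact ⟨V, hV, hφ.eventually he⟩

theorem CollapsesTo.tendsto_smul {γ : ℕ → G} {a b z : M} (h : CollapsesTo γ b a) (hz : z ≠ b) :
    Tendsto (fun n => γ n • z) atTop (𝓝 a) := by
  intro U hU
  obtain ⟨V, hV, he⟩ := h z hz U hU
  exact he.mono fun n hn => hn z (mem_of_mem_nhds hV) hz

theorem CollapsesTo.tendsto_smul_of_tendsto [T1Space M] {γ : ℕ → G} {a b z : M} {w : ℕ → M}
    (h : CollapsesTo γ b a) (hz : z ≠ b) (hw : Tendsto w atTop (𝓝 z)) :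
    Tendsto (fun n => γ n • w n) atTop (𝓝 a) := by
  intro U hU
  obtain ⟨V, hV, he⟩ := h z hz U hU
  change ∀ᶠ n in atTop, γ n • w n ∈ U
  filter_upwards [he, hw.eventually hV, hw.eventually (isOpen_ne.mem_nhds hz)] with n h1 h2 h3
  exact h1 _ h2 h3

theorem CollapsesTo.eventually_mapsTo {γ : ℕ → G} {a b : M} {K U : Set M}
    (h : CollapsesTo γ b a) (hK : IsCompact K) (hb : b ∉ K) (hU : U ∈ 𝓝 a) :
    ∀ᶠ n in atTop, ∀ w ∈ K, γ n • w ∈ U := by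
  have key : ∀ᶠ n in atTop, ∀ w ∈ K, w ≠ b → γ n • w ∈ U := by
    refine hK.induction_on (p := fun s => ∀ᶠ n in atTop, ∀ w ∈ s, w ≠ b → γ n • w ∈ U)
      (by simp) (fun s t hst ht => ht.mono fun n hn w hw => hn w (hst hw))
      (fun s t hs ht => ?_) fun x hx => ?_
    · filter_upwards [hs, ht] with n h1 h2 w hw
      exact hw.elim (h1 w) (h2 w)
    · obtain ⟨V, hV, he⟩ := h x (fun e => hb (e ▸ hx)) U hU
      exact ⟨V, mem_nhdsWithin_of_mem_nhds hV, he⟩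
  exact key.mono fun n hn w hw => hn w hw fun e => hb (e ▸ hw)

theorem IsNonElementary.exists_ne_ne (h : IsNonElementary G M) (p q : M) :
    ∃ z : M, z ≠ p ∧ z ≠ q := by
  by_contra! h'
  have h1 : limitSet G M ⊆ {p, q} := fun z _ => by
    by_cases hz : z = p
    · exact Or.inl hz
    · exact Or.inr (h' z hz)
  have h2 := (h.trans (encard_le_encard h1)).trans (encard_insert_le {q} p)
  rw [encard_singleton, one_add_one_eq_two] at h2
  exact absurd h2 (by decide)

/-- The attracting points of a collapsing sequence of loxodromic elements do not converge to the
repelling point of the sequence, unless the repelling points do. -/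
theorem CollapsesTo.ne_of_isLoxodromic [T2Space M] [CompactSpace M]
    (hM : ∀ p q : M, ∃ z : M, z ≠ p ∧ z ≠ q) {γ : ℕ → G} {A B p q : M} {a b : ℕ → M}
    (h : CollapsesTo γ B A) (hlox : ∀ n, IsLoxodromic (γ n) (a n) (b n))
    (ha : Tendsto a atTop (𝓝 p)) (hb : Tendsto b atTop (𝓝 q)) (hpq : p ≠ q) : p ≠ B := by
  rintro rfl
  -- If `p` were the repelling point, the fixed points `b n → q ≠ p` would be drawn to `A`, so `q =
  -- A`.
  have h1 := h.tendsto_smul_of_tendsto hpq.symm hb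
  simp only [(hlox _).repelling_fixed] at h1
  obtain rfl : q = A := tendsto_nhds_unique hb h1
  obtain ⟨U, ⟨hU, hUc⟩, hpU⟩ := (closed_nhds_basis q).mem_iff.1 (isOpen_ne.mem_nhds hpq.symm)
  have hpU' : p ∉ U := fun hp => hpU hp rfl
  obtain ⟨z, hzp, hzq⟩ := hM p q
  have h2 := h.eventually_mapsTo hUc.isCompact hpU' hU
  have h3 := (h.tendsto_smul hzp).eventually hU
  have h4 := hb.eventually (isOpen_ne.mem_nhds hzq.symm)
  refine hpU' (hUc.mem_of_tendsto ha ?_)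
  filter_upwards [h2, h3, h4] with n h2 h3 h4
  -- For large `n`, `γ n` maps `U` into itself and `z` into `U`. The forward orbit of `z` converges
  -- to `a n`, so `a n ∈ U`, contradicting `a n → p ∉ U`.
  have h5 : ∀ k : ℕ, γ n ^ (k + 1) • z ∈ U := by
    intro k
    induction k with
    | zero => rw [zero_add, pow_one]; exact h3
    | succ k ih =>
      rw [pow_succ', mul_smul]
      exact h2 _ ih
  have h6 := ((hlox n).attracts.tendsto_smul (Ne.symm h4)).comp (tendsto_add_atTop_nat 1)
  exact hUc.mem_of_tendsto h6 (Eventually.of_forall h5)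

/-- In a compatible metric, a collapsing sequence of distinct elements converges to its
attracting point. -/
theorem IsCompatibleMetric.tendsto_elt [CompactSpace M] [TopologicalSpace.MetrizableSpace M]
    (hM : ∀ p q : M, ∃ z : M, z ≠ p ∧ z ≠ q) {d : MetricSpace (GroupUnion G M)}
    (hd : IsCompatibleMetric d) {γ : ℕ → G} (hγ : Function.Injective γ) {a b : M}
    (h : CollapsesTo γ b a) :
    Tendsto (fun n => (GroupUnion.elt (γ n) : GroupUnion G M)) atTop (𝓝 (.pt a)) := by
  refine tendsto_of_subseq_tendsto fun ns hns => ?_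
  obtain ⟨φ, hφ, hnsφ⟩ := strictMono_subseq_of_tendsto_atTop hns
  obtain ⟨A, B, φ', hφ', hAB⟩ := hd.convergence.collapse (γ ∘ (ns ∘ φ))
    (hγ.comp hnsφ.injective)
  have h' : CollapsesTo (γ ∘ (ns ∘ φ) ∘ φ') b a := h.comp (hnsφ.comp hφ').tendsto_atTop
  have hpt := hd.embedding_pt.continuous
  obtain ⟨z, hzb, hzB⟩ : ∃ z : M, z ≠ b ∧ GroupUnion.pt z ≠ B := by
    rcases B with g | b'
    · obtain ⟨z, hz, -⟩ := hM b b
      exact ⟨z, hz, by simp⟩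
    · obtain ⟨z, hz, hz'⟩ := hM b b'
      exact ⟨z, hz, fun e => hz' (GroupUnion.pt.inj e)⟩
  obtain rfl : A = .pt a := tendsto_nhds_unique (hAB.tendsto_smul hzB)
    ((hpt.tendsto a).comp (h'.tendsto_smul hzb))
  -- If the identity were the repelling point, the preimages of `c ≠ a` would accumulate in `M`,
  -- away from it, and their images, all equal to `c`, would tend to `a`. Once this is excluded,
  -- collapsing applies to `1`, whose images are the elements of the sequence.
  have hB : GroupUnion.elt 1 ≠ B := by
    rintro rfl
    obtain ⟨c, hc, -⟩ := hM a a
    obtain ⟨w, φ₂, hφ₂, hw⟩ := CompactSpace.tendsto_subseq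
      fun n => (γ (ns (φ (φ' n))))⁻¹ • c
    have h1 := (hAB.comp hφ₂.tendsto_atTop).tendsto_smul_of_tendsto
      (z := .pt w) (by simp) ((hpt.tendsto w).comp hw)
    have h2 : ∀ n, (γ ∘ (ns ∘ φ)) (φ' (φ₂ n)) •
        (GroupUnion.pt ((γ (ns (φ (φ' (φ₂ n)))))⁻¹ • c) : GroupUnion G M) = .pt c := fun n =>
      congrArg GroupUnion.pt (smul_inv_smul _ c)
    have h3 := tendsto_nhds_unique (h1.congr h2) tendsto_const_nhds
    exact hc (GroupUnion.pt.inj h3).symm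
  refine ⟨φ ∘ φ', (hAB.tendsto_smul hB).congr fun n => ?_⟩
  exact congrArg GroupUnion.elt (mul_one _)

end Collapse

/-! ## Properness and magnitude -/

section Final

variable {X : Type u} [MetricSpace X] [ProperSpace X] {δ : ℝ} {Γ : Subgroup (X ≃ᵢ X)}

open GromovBordification

/-- With respect to a compatible metric, boundary points far from `γ⁻¹` are far from `γ⁻¹ o`. -/
theorem IsCompatibleMetric.exists_not_near (H : HyperbolicWith X δ) (hgeod : IsGeodesicSpace X)
    (hdisc : IsDiscreteIsometryGroup Γ) (hne : IsNonElementary Γ (GromovBoundary X)) (o : X)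
    {d : MetricSpace (GroupUnion Γ (GromovBoundary X))} (hd : IsCompatibleMetric d) {ε : ℝ}
    (hε : 0 < ε) : ∃ R, ∀ (g : Γ) (x : GromovBoundary X),
      ε < dist (GroupUnion.pt x : GroupUnion Γ (GromovBoundary X)) (GroupUnion.elt g⁻¹) →
        ¬ Near o R (bdry x) (of ((g⁻¹ : Γ).1 o)) := by
  by_contra! hcon
  choose g x hgx hnear using fun n : ℕ => hcon n
  have hM := H.boundary_isConvergenceGroup hgeod hdisc o
  have := hM.compact
  have := hM.metrizable
  have hlarge : Tendsto (fun n => dist o (((g n)⁻¹ : Γ).1 o)) atTop atTop :=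
    tendsto_atTop_mono (fun n => (hnear n).le_dist) tendsto_natCast_atTop_atTop
  -- Strictly increasing displacements make the selected elements distinct.
  obtain ⟨φ, hφ, hφ'⟩ := strictMono_subseq_of_tendsto_atTop hlarge
  have hinj : Function.Injective fun n => (g (φ n))⁻¹ := fun m n hmn =>
    hφ'.injective (congrArg (fun γ : Γ => dist o (γ.1 o)) hmn)
  obtain ⟨a, b, φ₂, hφ₂, hab⟩ := H.exists_orbitTendsto hgeod hdisc o hinj
  have h1 := hd.tendsto_elt hne.exists_ne_ne (hinj.comp hφ₂.injective) (hab.collapsesTo H)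
  -- The points `x n` share the limit `a` of the orbit points, while the group elements tend to `a`
  -- in `d`; this contradicts the separation by `ε`.
  have h2 : Tendsto (fun n => x (φ (φ₂ n))) atTop (𝓝 a) := by
    intro S hS
    obtain ⟨R, hR⟩ := (H.mem_nhds_boundary_iff o).1 hS
    change ∀ᶠ n in atTop, x (φ (φ₂ n)) ∈ S
    filter_upwards [hab.attracting (R + δ), (hφ.comp hφ₂).tendsto_atTop.eventually
      (eventually_ge_atTop ⌈R + δ⌉₊)] with n hn hn'
    have hnR : R + δ ≤ (φ (φ₂ n) : ℕ) := (Nat.le_ceil _).trans (by exact_mod_cast hn')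
    exact hR _ ((hn.trans H ((hnear _).mono hnR).symm).mono (by linarith))
  have h3 := ((hd.embedding_pt.continuous.tendsto a).comp h2).dist h1
  rw [dist_self] at h3
  have h4 := ge_of_tendsto h3 (Eventually.of_forall fun n => (hgx (φ (φ₂ n))).le)
  linarith

/-- A function on `Γ × ∂X` which away from `γ⁻¹ o` is within bounded distance of a proper
function on `Γ` is proper. -/
theorem HyperbolicWith.isProperCocycle (H : HyperbolicWith X δ) (hgeod : IsGeodesicSpace X)
    (hdisc : IsDiscreteIsometryGroup Γ) (hne : IsNonElementary Γ (GromovBoundary X)) (o : X)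
    {σ : Γ → GromovBoundary X → ℝ} {f : Γ → ℝ} (hf : Tendsto f cofinite atTop)
    (hσ : ∀ R, ∃ C, ∀ (g : Γ) (x : GromovBoundary X),
      ¬ Near o R (bdry x) (of ((g⁻¹ : Γ).1 o)) → |σ g x - f g| ≤ C) : IsProperCocycle σ := by
  rintro d hd γ a b hγ hlox ⟨ε, hε, hsep⟩
  have hM := H.boundary_isConvergenceGroup hgeod hdisc o
  have := hM.compact
  have := hM.metrizable
  have hpt := hd.embedding_pt.continuous
  refine tendsto_of_subseq_tendsto fun ns hns => ?_
  obtain ⟨φ, -, hnsφ⟩ := strictMono_subseq_of_tendsto_atTop hns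
  obtain ⟨A, B, φ₁, hφ₁, hAB⟩ := H.exists_orbitTendsto hgeod hdisc o (hγ.comp hnsφ.injective)
  obtain ⟨p, φ₂, hφ₂, hp⟩ := CompactSpace.tendsto_subseq fun n => a (ns (φ (φ₁ n)))
  obtain ⟨q, φ₃, hφ₃, hq⟩ := CompactSpace.tendsto_subseq fun n => b (ns (φ (φ₁ (φ₂ n))))
  have hp' := hp.comp hφ₃.tendsto_atTop
  have hAB' := hAB.comp (hφ₂.comp hφ₃)
  have hθ : StrictMono fun n => ns (φ (φ₁ (φ₂ (φ₃ n)))) :=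
    hnsφ.comp (hφ₁.comp (hφ₂.comp hφ₃))
  have hpq : p ≠ q := by
    rintro rfl
    have h3 := ((hpt.tendsto p).comp hq).dist ((hpt.tendsto p).comp hp')
    rw [dist_self] at h3
    have h4 := ge_of_tendsto h3 (hθ.tendsto_atTop.eventually hsep)
    linarith
  have hpB : p ≠ B := (hAB'.collapsesTo H).ne_of_isLoxodromic hne.exists_ne_ne
    (fun n => hlox (ns (φ (φ₁ (φ₂ (φ₃ n)))))) hp' hq hpq
  obtain ⟨S, hS⟩ := H.exists_not_near o hpB
  -- As `a n` is near `p` and `γₙ⁻¹ o` is near `B`, two uses of transitivity show that their mutual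
  -- nearness at level `S + 2 * δ` would make `p` and `B` near at level `S`.
  obtain ⟨C, hC⟩ := hσ (S + 2 * δ)
  have hδ := H.nonneg
  refine ⟨fun n => φ (φ₁ (φ₂ (φ₃ n))), ?_⟩
  have hfγ : Tendsto (fun n => f (γ (ns (φ (φ₁ (φ₂ (φ₃ n)))))) - C) atTop atTop := by
    refine tendsto_atTop_add_const_right _ _ (hf.comp ?_)
    have := (hγ.comp hθ.injective).tendsto_cofinite
    rwa [Nat.cofinite_eq_atTop] at this
  refine tendsto_atTop_mono' _ ?_ hfγ
  filter_upwards [hAB'.repelling (S + 2 * δ),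
    hp'.eventually (H.eventually_nhds_near o (S + 2 * δ) p)] with n h1 h2
  have h3 := abs_le.1 (hC _ (a (ns (φ (φ₁ (φ₂ (φ₃ n)))))) fun h3 =>
    hS (((Near.trans H h2 h3).trans H (h1.symm.mono (by linarith))).mono (by linarith)))
  simp only [Function.comp_apply] at h3
  linarith

end Final

theorem theorem1p8 {X : Type*} [MetricSpace X] [ProperSpace X]
    (hgeod : IsGeodesicSpace X) (hhyp : IsGromovHyperbolic X)
    (Γ : Subgroup (X ≃ᵢ X)) (hdisc : IsDiscreteIsometryGroup Γ)
    (hne : IsNonElementary Γ (GromovBoundary X)) (o : X)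
    (ψ : X → X → ℝ) (hψ : IsCoarselyAdditivePotential ψ)
    (hinv : ∀ γ ∈ Γ, ∀ p q : X, ψ (γ p) (γ q) = ψ p q) :
    (∀ (γ : Γ) (x : GromovBoundary X),
      potentialCocycle ψ o γ x ≠ ⊥ ∧ potentialCocycle ψ o γ x ≠ ⊤) ∧
    (∀ (γ : Γ) (x : GromovBoundary X),
      potentialCocycleBar ψ o γ x ≠ ⊥ ∧ potentialCocycleBar ψ o γ x ≠ ⊤) ∧
    (∀ z : DistinctPairs (GromovBoundary X),
      potentialGromovProd ψ o z ≠ ⊥ ∧ potentialGromovProd ψ o z ≠ ⊤) ∧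
    (∃ c : ℝ, ∀ z : DistinctPairs (GromovBoundary X), (c : EReal) ≤ potentialGromovProd ψ o z) ∧
    (∃ κ : ℝ, IsCoarseGPSSystem κ
      (fun (γ : Γ) (x : GromovBoundary X) => (potentialCocycle ψ o γ x).toReal)
      (fun (γ : Γ) (x : GromovBoundary X) => (potentialCocycleBar ψ o γ x).toReal)
      (fun z : DistinctPairs (GromovBoundary X) => (potentialGromovProd ψ o z).toReal)) ∧
    (∃ d : MetricSpace (GroupUnion Γ (GromovBoundary X)), IsCompatibleMetric d) ∧
    IsExpandingWithMagnitude
      (fun (γ : Γ) (x : GromovBoundary X) => (potentialCocycle ψ o γ x).toReal)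
      (fun γ : Γ => ψ o ((γ : X ≃ᵢ X) o)) := by
  obtain ⟨δ, H⟩ := exists_hyperbolicWith hgeod hhyp
  obtain ⟨_, _, happrox⟩ := hψ.exists_cocycle_approx H
  obtain ⟨κ, hσ, hσbar⟩ := hψ.exists_isCoarseCocycle H o hinv
  obtain ⟨κ', hid⟩ := hψ.exists_coarse_identity H o hinv
  -- The comparison of `σ_ψ` with `ψ` naturally produces `ψ(γ⁻¹ o, o)`; invariance turns it into the
  -- stated magnitude.
  have hflip : ∀ g : Γ, ψ ((g⁻¹ : Γ).1 o) o = ψ o (g.1 o) := fun g => by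
    rw [← hinv _ g.2, apply_apply_inv_of_subgroup]
  have hfar : ∀ A : ℝ, ∀ᶠ g : Γ in cofinite, ∀ p q : X, dist p q = dist o (g.1 o) →
      A ≤ ψ p q := by
    intro A
    obtain ⟨r, hr⟩ := hψ.proper A
    filter_upwards [(hdisc.tendsto_cofinite o).eventually_ge_atTop r] with g hg p q hpq
    exact hr p q (hpq ▸ hg)
  have hproper : IsProperCocycle
      (fun (γ : Γ) (x : GromovBoundary X) => (potentialCocycle ψ o γ x).toReal) := by
    refine H.isProperCocycle hgeod hdisc hne o (f := fun g => ψ ((g⁻¹ : Γ).1 o) o) ?_ fun R => ?_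
    · refine tendsto_atTop.2 fun A => (hfar A).mono fun g hg => hg _ _ ?_
      rw [dist_comm, dist_inv_apply]
    · obtain ⟨C, -, hC⟩ := hψ.exists_magnitude_bound (Γ := Γ) H o R
      exact ⟨C, fun g x hx => (hC g x hx).1⟩
  have hproper_bar : IsProperCocycle
      (fun (γ : Γ) (x : GromovBoundary X) => (potentialCocycleBar ψ o γ x).toReal) := by
    refine H.isProperCocycle hgeod hdisc hne o (f := fun g => ψ o ((g⁻¹ : Γ).1 o)) ?_ fun R => ?_
    · exact tendsto_atTop.2 fun A => (hfar A).mono fun g hg => hg _ _ (dist_inv_apply o g)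
    · obtain ⟨C, -, hC⟩ := hψ.exists_magnitude_bound (Γ := Γ) H o R
      exact ⟨C, fun g x hx => (hC g x hx).2⟩
  refine ⟨fun γ x => (happrox Γ o γ x).1.1, fun γ x => (happrox Γ o γ x).2.1,
    hψ.potentialGromovProd_ne H o, hψ.exists_le_potentialGromovProd H o, ⟨max κ κ', ?_⟩,
    H.exists_isCompatibleMetric hgeod hdisc o, ?_⟩
  · exact
      { convergence := H.boundary_isConvergenceGroup hgeod hdisc o
        nonelementary := hne
        cocycle := hσ.mono (le_max_left _ _)
        proper := hproper
        cocycle_bar := hσbar.mono (le_max_left _ _)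
        proper_bar := hproper_bar
        locally_bounded := hψ.potentialGromovProd_locally_bounded H o
        coarse_identity := fun g p => (hid g p).trans (le_max_right _ _) }
  · refine ⟨⟨κ, hσ⟩, hproper, fun d hd ε hε => ?_⟩
    obtain ⟨R, hR⟩ := hd.exists_not_near H hgeod hdisc hne o hε
    obtain ⟨C, hC, h⟩ := hψ.exists_magnitude_bound (Γ := Γ) H o R
    refine ⟨C, hC, fun g x hx => ?_⟩
    have := abs_le.1 (h g x (hR g x hx)).1
    rw [hflip] at this
    constructor <;> linarith
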